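/- Let $\mathbb{K}=\mathbb{R}$ or $\mathbb{C}$ and let $(A,\wedge,\mathfrak d)$ be a differential graded algebra over $\mathbb{K}$: an associative (not necessarily unital) algebra $A=\bigoplus_{n\in\mathbb Z}A^n$ with $A^m\wedge A^n\subset A^{m+n}$, and a linear map $\mathfrak d$ of degree $1$ with $\mathfrak d^2=0$ and $\mathfrak d(a\wedge b)=\mathfrak da\wedge b+(-1)^{|a|}a\wedge\mathfrak db$. Let $\langle\cdot,\cdot\rangle$ be a Euclidean ($\mathbb{K}=\mathbb{R}$) or Hermitian ($\mathbb{K}=\mathbb{C}$) metric on $A$, i.e. a positive definite symmetric (Hermitian) form for which $A^m\perp A^n$ when $m\neq n$. Suppose that $\mathfrak d$ has a formal adjoint $\mathfrak d^*$, i.e. $\langle\mathfrak da,b\rangle=\langle a,\mathfrak d^*b\rangle$, put $\square=\mathfrak d\mathfrak d^*+\mathfrak d^*\mathfrak d$ and $\mathcal H=\operatorname{Ker}\square$, and suppose that $$A=\mathcal H\oplus\operatorname{Im}\mathfrak d\oplus\operatorname{Im}\mathfrak d^*.$$ Let $\alpha\mapsto\alpha^H$ be the resulting projection onto $\mathcal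 H$, and let $\alpha\circ\beta=(\alpha\wedge\beta)^H$ for $\alpha,\beta\in\mathcal H$. The restriction of $\square$ to $\operatorname{Im}\mathfrak d\oplus\operatorname{Im}\mathfrak d^*$ is invertible; let $G:A\to A$ be the projection onto $\operatorname{Im}\mathfrak d\oplus\operatorname{Im}\mathfrak d^*$ followed by the inverse of this restriction, and let $Q=G\mathfrak d^*$. Write $[\mathfrak d,Q]=\mathfrak dQ+Q\mathfrak d$. Define multilinear maps $\lambda_n$, $n\ge2$, on homogeneous elements of $A$ by $\lambda_2(v_1,v_2)=v_1\wedge v_2$ and, for $n\ge3$, $$\begin{aligned}\lambda_n(v_1,\dots,v_n)={}&(-1)^{n-1}\,Q\lambda_{n-1}(v_1,\dots,v_{n-1})\wedge v_n-(-1)^{n|v_1|}\,v_1\wedge Q\lambda_{n-1}(v_2,\dots,v_n)\\&-\sum_{\substack{k+l=n\\k,l\ge2}}(-1)^{k+(l-1)(|v_1|+\dots+|v_k|)}\,Q\lambda_k(v_1,\dots,v_k)\wedge Q\lambda_l(v_{k+1},\dots,v_n).\end{aligned}$$ **Theorem.** The space $\mathcal H$ is graded by $\mathcal H^n=\mathcal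 H\cap A^n$, it is a subcomplex of $(A,\mathfrak d)$, $Q$ has degree $-1$, and $(1-[\mathfrak d,Q])v\in\mathcal H$ for all $v\in A$. There is exactly one $A_\infty$ structure $(m_k)_{k\ge1}$ on $\mathcal H$ with $m_1=\mathfrak d|_{\mathcal H}$ and $m_k=(1-[\mathfrak d,Q])\lambda_k$ for $k\ge2$. For this structure $m_1=0$ and $m_2=\circ$. Here an $A_\infty$ structure on a graded vector space $W$ is a sequence of linear maps $m_k:W^{\otimes k}\to W$, $k\ge1$, of degree $2-k$, such that for all $n\ge1$ and all homogeneous $a_1,\dots,a_n\in W$ $$\sum_{\substack{j+l+t=n\\ l\ge1,\ j,t\ge0}}(-1)^{j+lt+l(|a_1|+\dots+|a_j|)}\,m_{j+1+t}\bigl(a_1,\dots,a_j,m_l(a_{j+1},\dots,a_{j+l}),a_{j+l+1},\dots,a_n\bigr)=0.$$ -/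

import Mathlib

/-! ### Differential graded algebras and `A∞`-algebras -/

/-- A differential graded algebra structure `(A, ∧, 𝔡)` on an associative (not necessarily unital)
`𝕜`-algebra `A`: a `ℤ`-grading compatible with the product, and a differential of degree `1`
satisfying the graded Leibniz rule. -/
structure DGAlgebra (𝕜 A : Type*) [Field 𝕜] [NonUnitalRing A] [Module 𝕜 A] where
  /-- The homogeneous pieces `Aⁿ`. -/
  grade : ℤ → Submodule 𝕜 A
  isInternal : DirectSum.IsInternal grade
  mul_mem : ∀ {m n : ℤ} {a b : A}, a ∈ grade m → b ∈ grade n → a * b ∈ grade (m + n)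
  /-- The differential. -/
  d : A →ₗ[𝕜] A
  d_mem : ∀ {n : ℤ} {a : A}, a ∈ grade n → d a ∈ grade (n + 1)
  d_d : ∀ a : A, d (d a) = 0
  leibniz : ∀ {n : ℤ} {a : A} (b : A), a ∈ grade n →
    d (a * b) = d a * b + n.negOnePow • (a * d b)

/-- The left-hand side of the `n`-th Stasheff identity, evaluated on the first `n` terms of the
sequence `a`, where `a i` is homogeneous of degree `e i`:
`∑ (-1)^(j + l t + l (e₀ + ⋯ + e_{j-1})) m_{j+1+t}(a₀, …, a_{j-1}, m_l(a_j, …, a_{j+l-1}), …)`,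
the sum being over `j + l + t = n` with `l ≥ 1`. -/
def stasheffSum {𝕜 W : Type*} [Field 𝕜] [AddCommGroup W] [Module 𝕜 W]
    (m : (k : ℕ) → MultilinearMap 𝕜 (fun _ : Fin k => W) W)
    (n : ℕ) (e : ℕ → ℤ) (a : ℕ → W) : W :=
  ∑ l ∈ Finset.Icc 1 n, ∑ j ∈ Finset.range (n - l + 1),
    ((j : ℤ) + l * (n - l - j) + l * ∑ i ∈ Finset.range j, e i).negOnePow •
      m (n - l + 1) (fun i : Fin (n - l + 1) =>
        if (i : ℕ) < j then a i
        else if (i : ℕ) = j then m l (fun s : Fin l => a (j + s))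
        else a (i + l - 1))

/-- An `A∞`-structure on a graded vector space `W = ⨁ Wⁿ`: linear maps `m_k : W^{⊗ k} → W`, `k ≥ 1`,
of degree `2 - k`, satisfying the Stasheff identities. There is no `m₀`; the index `0` is filled
with the zero map. -/
structure AInfinityStructure (𝕜 W : Type*) [Field 𝕜] [AddCommGroup W] [Module 𝕜 W]
    (grade : ℤ → Submodule 𝕜 W) where
  m : (k : ℕ) → MultilinearMap 𝕜 (fun _ : Fin k => W) W
  m_zero : m 0 = 0
  degree : ∀ k : ℕ, 1 ≤ k → ∀ (e : Fin k → ℤ) (a : Fin k → W), (∀ i, a i ∈ grade (e i)) →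
    m k a ∈ grade (∑ i, e i + 2 - k)
  stasheff : ∀ n : ℕ, 1 ≤ n → ∀ (e : ℕ → ℤ) (a : ℕ → W), (∀ i < n, a i ∈ grade (e i)) →
    stasheffSum m n e a = 0

/-! ### Merkulov's construction -/

/-- The data of Merkulov's construction: a subcomplex `W` of `(V, d)` and an odd operator `Q`
(of degree `-1`) such that `(1 - [d, Q]) v ∈ W` for all `v`. -/
structure IsMerkulovDatum {𝕜 V : Type*} [Field 𝕜] [NonUnitalRing V] [Module 𝕜 V]
    (X : DGAlgebra 𝕜 V) (W : Submodule 𝕜 V) (Q : V →ₗ[𝕜] V) : Prop where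
  d_mem : ∀ w ∈ W, X.d w ∈ W
  Q_degree : ∀ (n : ℤ), ∀ v ∈ X.grade n, Q v ∈ X.grade (n - 1)
  proj_mem : ∀ v : V, v - (X.d (Q v) + Q (X.d v)) ∈ W

/-- Merkulov's maps `λ_n`, `n ≥ 2`, evaluated on the first `n` terms of the sequence `v`, where
`v i` is homogeneous of degree `e i`: `λ₂(v₁, v₂) = v₁ v₂` and, for `n ≥ 3`,
`λ_n(v₁, …, v_n) = (-1)^{n-1} Qλ_{n-1}(v₁, …, v_{n-1}) v_n - (-1)^{n |v₁|} v₁ Qλ_{n-1}(v₂, …, v_n)`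
`- ∑_{k + l = n, k, l ≥ 2} (-1)^{k + (l-1)(|v₁| + ⋯ + |v_k|)}`
`Qλ_k(v₁, …, v_k) Qλ_l(v_{k+1}, …, v_n)`.
In the code below the sum is over `k = r + 2`, `l = n + 1 - r`, `r < n`, with `n + 3` in place
of `n`. -/
def merkulovLambda {𝕜 V : Type*} [Field 𝕜] [NonUnitalRing V] [Module 𝕜 V] (Q : V →ₗ[𝕜] V) :
    ℕ → (ℕ → ℤ) → (ℕ → V) → V
  | 0, _, _ => 0
  | 1, _, _ => 0
  | 2, _, v => v 0 * v 1
  | n + 3, e, v =>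
      ((n : ℤ) + 2).negOnePow • (Q (merkulovLambda Q (n + 2) e v) * v (n + 2))
      - (((n : ℤ) + 3) * e 0).negOnePow •
          (v 0 * Q (merkulovLambda Q (n + 2) (fun i => e (1 + i)) (fun i => v (1 + i))))
      - ∑ r : Fin n,
          (((r : ℤ) + 2) + ((n : ℤ) + 1 - r - 1) *
              ∑ i ∈ Finset.range ((r : ℕ) + 2), e i).negOnePow •
            (Q (merkulovLambda Q ((r : ℕ) + 2) e v) *
              Q (merkulovLambda Q (n + 1 - (r : ℕ))
                (fun i => e ((r : ℕ) + 2 + i)) (fun i => v ((r : ℕ) + 2 + i))))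
termination_by n => n
decreasing_by all_goals omega

/-- `M` is the `A∞`-structure on `W` given by Merkulov's construction: `m₁ = d` and
`m_k = (1 - [d, Q]) λ_k` for `k ≥ 2` (on homogeneous elements, which determines `m_k`). -/
def IsMerkulovStructure {𝕜 V : Type*} [Field 𝕜] [NonUnitalRing V] [Module 𝕜 V]
    (X : DGAlgebra 𝕜 V) (W : Submodule 𝕜 V) (Q : V →ₗ[𝕜] V)
    {grade : ℤ → Submodule 𝕜 W} (M : AInfinityStructure 𝕜 W grade) : Prop :=
  (∀ w : W, (M.m 1 (fun _ => w) : V) = X.d w) ∧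
  ∀ k : ℕ, 2 ≤ k → ∀ (e : ℕ → ℤ) (w : ℕ → W), (∀ i < k, w i ∈ grade (e i)) →
    (M.m k (fun i : Fin k => w i) : V) =
      merkulovLambda Q k e (fun i => (w i : V))
        - (X.d (Q (merkulovLambda Q k e (fun i => (w i : V))))
          + Q (X.d (merkulovLambda Q k e (fun i => (w i : V)))))

/-! ### Abstract Hodge theory -/

/-- A differential graded algebra with a Euclidean (`𝕜 = ℝ`) or Hermitian (`𝕜 = ℂ`) metric, for
which elements of distinct degrees are orthogonal, together with a formal adjoint `𝔡*` of the
differential. -/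
structure MetricDGAlgebra (𝕜 A : Type*) [RCLike 𝕜] [NonUnitalRing A] [Module 𝕜 A]
    extends DGAlgebra 𝕜 A where
  /-- The metric: a positive definite Hermitian form. -/
  metric : InnerProductSpace.Core 𝕜 A
  orthogonal : ∀ {m n : ℤ}, m ≠ n → ∀ {a b : A}, a ∈ grade m → b ∈ grade n →
    metric.inner a b = 0
  /-- The formal adjoint `𝔡*` of the differential. -/
  dStar : A →ₗ[𝕜] A
  adjoint : ∀ a b : A, metric.inner (d a) b = metric.inner a (dStar b)

namespace MetricDGAlgebra

variable {𝕜 A : Type*} [RCLike 𝕜] [NonUnitalRing A] [Module 𝕜 A] (X : MetricDGAlgebra 𝕜 A)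

/-- `□ = 𝔡𝔡* + 𝔡*𝔡`. -/
def laplacian : A →ₗ[𝕜] A := X.d ∘ₗ X.dStar + X.dStar ∘ₗ X.d

/-- The harmonic space `𝓗 = Ker □`. -/
def harmonic : Submodule 𝕜 A := LinearMap.ker X.laplacian

/-- `Im 𝔡 + Im 𝔡*`. -/
def exactPart : Submodule 𝕜 A := LinearMap.range X.d ⊔ LinearMap.range X.dStar

/-- The Hodge decomposition `A = 𝓗 ⊕ Im 𝔡 ⊕ Im 𝔡*` (internal direct sum). -/
def HasHodgeDecomposition : Prop :=
  DirectSum.IsInternal ![X.harmonic, LinearMap.range X.d, LinearMap.range X.dStar]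

/-- The induced grading `𝓗ⁿ = 𝓗 ∩ Aⁿ` of the harmonic space. -/
def harmonicGrade (n : ℤ) : Submodule 𝕜 X.harmonic := (X.grade n).comap X.harmonic.subtype

theorem laplacian_apply (a : A) : X.laplacian a = X.d (X.dStar a) + X.dStar (X.d a) := rfl

theorem dStar_dStar (a : A) : X.dStar (X.dStar a) = 0 := by
  apply X.metric.definite
  rw [← X.adjoint, ← X.adjoint, X.d_d]
  let _ := X.metric
  exact InnerProductSpace.Core.inner_zero_left (𝕜 := 𝕜) (F := A) _

theorem mem_harmonic_iff (a : A) : a ∈ X.harmonic ↔ X.d a = 0 ∧ X.dStar a = 0 := by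
  constructor
  · intro h
    have h0 : X.d (X.dStar a) + X.dStar (X.d a) = 0 := h
    have h1 : X.metric.inner (X.dStar a) (X.dStar a) + X.metric.inner (X.d a) (X.d a) = 0 := by
      have e1 : X.metric.inner (X.dStar a) (X.dStar a)
          = X.metric.inner (X.d (X.dStar a)) a := (X.adjoint _ _).symm
      have e2 : X.metric.inner (X.d a) (X.d a) = X.metric.inner (X.dStar (X.d a)) a := by
        rw [← X.metric.conj_inner_symm (X.dStar (X.d a)) a, ← X.adjoint,
          X.metric.conj_inner_symm]
      rw [e1, e2, ← X.metric.add_left, h0]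
      let _ := X.metric
      exact InnerProductSpace.Core.inner_zero_left (𝕜 := 𝕜) (F := A) _
    have hre := congrArg RCLike.re h1
    rw [map_add, map_zero] at hre
    have p1 := X.metric.re_inner_nonneg (X.dStar a)
    have p2 := X.metric.re_inner_nonneg (X.d a)
    have key : ∀ x : A, RCLike.re (X.metric.inner x x) = 0 → x = 0 := by
      intro x hx
      apply X.metric.definite
      let _ := X.metric
      have := InnerProductSpace.Core.inner_self_ofReal_re (𝕜 := 𝕜) x
      change ((RCLike.re (X.metric.inner x x) : ℝ) : 𝕜) = X.metric.inner x x at this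
      rw [← this, hx, RCLike.ofReal_zero]
    exact ⟨key _ (by linarith), key _ (by linarith)⟩
  · rintro ⟨h1, h2⟩
    change X.d (X.dStar a) + X.dStar (X.d a) = 0
    rw [h1, h2, map_zero, map_zero, add_zero]

variable {X}

theorem HasHodgeDecomposition.isCompl (hX : X.HasHodgeDecomposition) :
    IsCompl X.harmonic X.exactPart := by
  have h := (DirectSum.isInternal_submodule_iff_iSupIndep_and_iSup_eq_top _).1 hX
  constructor
  · have := h.1 0
    refine this.mono_right ?_
    refine sup_le ?_ ?_
    · exact le_iSup₂_of_le (f := fun (j : Fin 3) (_ : j ≠ 0) =>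
        (![X.harmonic, LinearMap.range X.d, LinearMap.range X.dStar] : Fin 3 → _) j)
        1 (by decide) le_rfl
    · exact le_iSup₂_of_le (f := fun (j : Fin 3) (_ : j ≠ 0) =>
        (![X.harmonic, LinearMap.range X.d, LinearMap.range X.dStar] : Fin 3 → _) j)
        2 (by decide) le_rfl
  · rw [codisjoint_iff, eq_top_iff, ← h.2]
    refine iSup_le fun i => ?_
    fin_cases i
    · exact le_sup_left
    · exact le_sup_left.trans (le_sup_right (a := X.harmonic) (b := X.exactPart))
    · exact le_sup_right.trans (le_sup_right (a := X.harmonic) (b := X.exactPart))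

theorem laplacian_mem_exactPart (a : A) : X.laplacian a ∈ X.exactPart :=
  Submodule.add_mem_sup ⟨_, rfl⟩ ⟨_, rfl⟩

variable (X) in
/-- The restriction of `□` to `Im 𝔡 ⊕ Im 𝔡*`. -/
def laplacianExact : X.exactPart →ₗ[𝕜] X.exactPart :=
  X.laplacian.restrict fun a _ => laplacian_mem_exactPart a

theorem HasHodgeDecomposition.exists_eq (hX : X.HasHodgeDecomposition) (a : A) :
    ∃ h x y : A, X.d h = 0 ∧ X.dStar h = 0 ∧ a = h + (X.d x + X.dStar y) := by
  have ht : a ∈ X.harmonic ⊔ X.exactPart := by rw [hX.isCompl.sup_eq_top]; trivial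
  obtain ⟨h, hh, r, hr, rfl⟩ := Submodule.mem_sup.1 ht
  obtain ⟨_, ⟨x, rfl⟩, _, ⟨y, rfl⟩, rfl⟩ := Submodule.mem_sup.1 hr
  obtain ⟨h1, h2⟩ := (X.mem_harmonic_iff h).1 hh
  exact ⟨h, x, y, h1, h2, rfl⟩

theorem HasHodgeDecomposition.laplacianExact_bijective (hX : X.HasHodgeDecomposition) :
    Function.Bijective X.laplacianExact := by
  constructor
  · rw [injective_iff_map_eq_zero]
    intro a ha
    have ha' : (a : A) ∈ X.harmonic := congrArg Subtype.val ha
    exact Subtype.ext (Submodule.disjoint_def.1 hX.isCompl.disjoint _ ha' a.2)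
  · rintro ⟨a, ha⟩
    obtain ⟨_, ⟨u, rfl⟩, _, ⟨v, rfl⟩, rfl⟩ := Submodule.mem_sup.1 ha
    obtain ⟨h, x, y, h1, -, rfl⟩ := hX.exists_eq u
    obtain ⟨h', x', y', -, h2', rfl⟩ := hX.exists_eq v
    obtain ⟨k, p, q, -, k2, rfl⟩ := hX.exists_eq y
    obtain ⟨k', p', q', k1', -, rfl⟩ := hX.exists_eq x'
    refine ⟨⟨X.d p + X.dStar q', Submodule.add_mem_sup ⟨_, rfl⟩ ⟨_, rfl⟩⟩, Subtype.ext ?_⟩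
    change X.laplacian (X.d p + X.dStar q') = _
    simp only [laplacian_apply, map_add, X.d_d, X.dStar_dStar, h1, h2', k2, k1',
      map_zero, zero_add, add_zero]

/-- The harmonic part `α ↦ α^H`: the projection of `A = 𝓗 ⊕ Im 𝔡 ⊕ Im 𝔡*` onto `𝓗`. -/
noncomputable def harmonicPart (hX : X.HasHodgeDecomposition) : A →ₗ[𝕜] X.harmonic :=
  X.harmonic.projectionOnto X.exactPart hX.isCompl

/-- Green's operator `G`: the projection onto `Im 𝔡 ⊕ Im 𝔡*`, followed by the inverse of the
restriction of `□` to it, followed by the inclusion. -/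
noncomputable def green (hX : X.HasHodgeDecomposition) : A →ₗ[𝕜] A :=
  X.exactPart.subtype ∘ₗ
    (LinearEquiv.ofBijective X.laplacianExact hX.laplacianExact_bijective).symm.toLinearMap ∘ₗ
    X.exactPart.projectionOnto X.harmonic hX.isCompl.symm

/-- The operator `Q = G𝔡*`. -/
noncomputable def hodgeHomotopy (hX : X.HasHodgeDecomposition) : A →ₗ[𝕜] A :=
  green hX ∘ₗ X.dStar

/-- The harmonic product `α ∘ β = (α ∧ β)^H`. -/
noncomputable def harmonicProduct (hX : X.HasHodgeDecomposition) (α β : X.harmonic) : X.harmonic :=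
  harmonicPart hX ((α : A) * (β : A))

end MetricDGAlgebra

/-!
Merkulov's transfer of a differential graded algebra to its harmonic space.

*Hodge theory.* Orthogonality of the homogeneous pieces makes `𝔡*` an operator of degree `-1`, so
`□` preserves degrees and the harmonic space is graded. Green's operator commutes with `𝔡`, which
gives the homotopy formula `1 - [𝔡, Q] = (·)^H` (`MetricDGAlgebra.sub_bracket_hodgeHomotopy`).

*The Stasheff identities.* After the usual shift of degrees nearly all signs disappear. Let `ε` be
the parity involution, `s = -ε`, `H = -Q`, and `μ(x, y) = ε(x) y`; then `d` is a derivation of `μ`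
and `μ` is associative, both in the sense of operations of degree `1` on the shifted space. On words
in `A` put `f(a) = a`, `λ(w) = ∑_{w = uv} μ(f u, f v)`, `f(w) = H λ(w)` for words of length at least
two, and `b = (1 + dH + Hd) λ`. Write `F ◁ b` for the sum of `F(s u, b x, v)` over all `w = u x v`.
Insertion is a coderivation (`insertSum_splitSum`), and by induction on the length of the word,
simultaneously,
`d λ = -(λ ◁ b)` and `d f + λ = f ◁ b` on closed letters (`DGAlgebra.d_barLambda`): in
`d λ(w) = -∑ (μ(d f u, f v) + μ(s f u, d f v))` the terms with `λ` cancel by associativity, and the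
others form `λ ◁ b`. Applying the harmonic projection, which kills the image of `d`, yields
`b ◁ b = 0` (`DGAlgebra.barInsert_barOp`). As `ε` is an operator, all this holds for arbitrary, not
necessarily homogeneous, letters.

*Signs.* On elements of degrees `e₀, …, e_{n-1}`, Merkulov's `λ_n` is
`(-1)^(∑ (n - 1 - i) eᵢ) λ` (`DGAlgebra.merkulovLambda_eq`). Under this substitution the `n`-th
Stasheff sum becomes the same sign times `b ◁ b`, term by term (`MetricDGAlgebra.stasheff_term`).

*Uniqueness.* The operations are prescribed on homogeneous elements, and these contain a basis of
the harmonic space.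
-/

/-! ### Homogeneous components and the parity involution -/

namespace DGAlgebra

variable {𝕜 A : Type*} [Field 𝕜] [NonUnitalRing A] [Module 𝕜 A] (X : DGAlgebra 𝕜 A)

theorem homogeneous_induction {p : A → Prop} (hom : ∀ (n : ℤ), ∀ a ∈ X.grade n, p a)
    (add : ∀ a b, p a → p b → p (a + b)) (a : A) : p a := by
  have ha : a ∈ ⨆ n, X.grade n := by
    rw [X.isInternal.submodule_iSup_eq_top]; trivial
  exact Submodule.iSup_induction X.grade (motive := p) ha hom
    (hom 0 0 (Submodule.zero_mem _)) add

theorem units_smul_mem {n : ℤ} {a : A} (u : ℤˣ) (ha : a ∈ X.grade n) : u • a ∈ X.grade n := by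
  rcases Int.units_eq_one_or u with rfl | rfl
  · simpa using ha
  · simpa [Units.smul_def] using ha

/-- The projection of `A = ⨁ Aⁿ` onto `Aⁿ`, as an endomorphism of `A`. -/
noncomputable def component (n : ℤ) : A →ₗ[𝕜] A :=
  (X.grade n).subtype ∘ₗ DirectSum.component 𝕜 ℤ (fun i => X.grade i) n ∘ₗ
    (LinearEquiv.ofBijective (DirectSum.coeLinearMap X.grade) X.isInternal).symm.toLinearMap

theorem component_mem (n : ℤ) (a : A) : X.component n a ∈ X.grade n := Subtype.prop _

theorem component_same {n : ℤ} {a : A} (ha : a ∈ X.grade n) : X.component n a = a :=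
  congrArg Subtype.val (X.isInternal.ofBijective_coeLinearMap_same ⟨a, ha⟩)

theorem component_of_ne {m n : ℤ} (h : m ≠ n) {a : A} (ha : a ∈ X.grade n) :
    X.component m a = 0 :=
  congrArg Subtype.val (X.isInternal.ofBijective_coeLinearMap_of_ne h.symm ⟨a, ha⟩)

theorem eq_zero_of_component (a : A) (h : ∀ n, X.component n a = 0) : a = 0 := by
  rw [← (LinearEquiv.ofBijective (DirectSum.coeLinearMap X.grade)
    X.isInternal).symm.map_eq_zero_iff]
  exact DFinsupp.ext fun n => Subtype.ext (h n)

theorem exists_eq_sum_component (a : A) : ∃ s : Finset ℤ, a = ∑ n ∈ s, X.component n a := by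
  classical
  let e := LinearEquiv.ofBijective (DirectSum.coeLinearMap X.grade) X.isInternal
  have h := DirectSum.coeLinearMap_eq_dfinsuppSum X.grade (e.symm a)
  rw [show DirectSum.coeLinearMap X.grade (e.symm a) = a from e.apply_symm_apply a] at h
  exact ⟨_, h⟩

theorem mem_grade_of_component {n : ℤ} {a : A} (h : ∀ m, m ≠ n → X.component m a = 0) :
    a ∈ X.grade n := by
  have : a - X.component n a = 0 := by
    refine X.eq_zero_of_component _ fun m => ?_
    rw [map_sub]
    by_cases hm : m = n
    · subst hm
      rw [X.component_same (X.component_mem _ _), sub_self]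
    · rw [h m hm, X.component_of_ne hm (X.component_mem _ _), sub_zero]
  rw [sub_eq_zero.1 this]
  exact X.component_mem _ _

/-- A linear map homogeneous of degree `k` intertwines the component projections. -/
theorem component_comm {f : A →ₗ[𝕜] A} {k : ℤ} (hf : ∀ n, ∀ a ∈ X.grade n, f a ∈ X.grade (n + k))
    (n : ℤ) (a : A) : X.component (n + k) (f a) = f (X.component n a) := by
  induction a using X.homogeneous_induction with
  | hom m a ha =>
    by_cases h : n = m
    · subst h
      rw [X.component_same ha, X.component_same (hf _ _ ha)]
    · rw [X.component_of_ne h ha, map_zero, X.component_of_ne _ (hf _ _ ha)]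
      omega
  | add a b ha hb => simp only [map_add, ha, hb]

/-- The parity involution `ε`, with `ε a = (-1)ⁿ a` for `a ∈ Aⁿ`. It turns Koszul signs into an
operator, so that the identities below can be stated for arbitrary, not only homogeneous,
elements. -/
noncomputable def parity : A →ₗ[𝕜] A :=
  DirectSum.toModule 𝕜 ℤ A (fun n => n.negOnePow • (X.grade n).subtype) ∘ₗ
    (LinearEquiv.ofBijective (DirectSum.coeLinearMap X.grade) X.isInternal).symm.toLinearMap

theorem parity_of_mem {n : ℤ} {a : A} (ha : a ∈ X.grade n) :
    X.parity a = n.negOnePow • a := by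
  have h : (LinearEquiv.ofBijective (DirectSum.coeLinearMap X.grade) X.isInternal).symm a
      = DirectSum.lof 𝕜 ℤ (fun i => X.grade i) n ⟨a, ha⟩ := by
    rw [LinearEquiv.symm_apply_eq]
    exact (DirectSum.coeLinearMap_lof X.grade n ⟨a, ha⟩).symm
  simp [parity, h]

theorem parity_parity (a : A) : X.parity (X.parity a) = a := by
  induction a using X.homogeneous_induction with
  | hom n a ha =>
    rw [X.parity_of_mem ha, X.parity_of_mem (X.units_smul_mem _ ha), smul_smul,
      Int.units_mul_self, one_smul]
  | add a b ha hb => rw [map_add, map_add, ha, hb]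

theorem parity_mul (a b : A) : X.parity (a * b) = X.parity a * X.parity b := by
  induction a using X.homogeneous_induction with
  | hom n a ha =>
    induction b using X.homogeneous_induction with
    | hom m b hb =>
      rw [X.parity_of_mem ha, X.parity_of_mem hb, X.parity_of_mem (X.mul_mem ha hb),
        Int.negOnePow_add]
      simp only [Units.smul_def, Units.val_mul, smul_mul_assoc, mul_smul_comm, smul_smul, mul_comm]
    | add b c hb hc => rw [mul_add, map_add, map_add, mul_add, hb, hc]
  | add a c ha hc => rw [add_mul, map_add, map_add, add_mul, ha, hc]

theorem parity_anticomm {f : A →ₗ[𝕜] A} {k : ℤ} (hk : Odd k)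
    (hf : ∀ n, ∀ a ∈ X.grade n, f a ∈ X.grade (n + k)) (a : A) :
    X.parity (f a) = -f (X.parity a) := by
  induction a using X.homogeneous_induction with
  | hom n a ha =>
    rw [X.parity_of_mem ha, X.parity_of_mem (hf _ _ ha), Int.negOnePow_add, Int.negOnePow_odd k hk]
    simp [Units.smul_def, map_zsmul]
  | add a b ha hb => simp only [map_add, ha, hb, neg_add]

theorem parity_d (a : A) : X.parity (X.d a) = -X.d (X.parity a) :=
  X.parity_anticomm odd_one (fun _ _ h => X.d_mem h) a

theorem d_mul (a b : A) : X.d (a * b) = X.d a * b + X.parity a * X.d b := by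
  induction a using X.homogeneous_induction with
  | hom n a ha =>
    rw [X.leibniz b ha, X.parity_of_mem ha, Units.smul_def, Units.smul_def, smul_mul_assoc]
  | add a c ha hc => simp only [add_mul, map_add, ha, hc]; abel

end DGAlgebra

/-! ### Hodge theory: degrees, Green's operator and the homotopy -/

namespace MetricDGAlgebra

variable {𝕜 A : Type*} [RCLike 𝕜] [NonUnitalRing A] [Module 𝕜 A] (X : MetricDGAlgebra 𝕜 A)

theorem inner_eq_inner_component {n : ℤ} {a : A} (ha : a ∈ X.grade n) (b : A) :
    X.metric.inner a b = X.metric.inner a (X.component n b) := by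
  let _ := X.metric
  induction b using X.homogeneous_induction with
  | hom m b hb =>
    by_cases h : n = m
    · subst h
      rw [X.component_same hb]
    · rw [X.component_of_ne h hb, X.orthogonal h ha hb]
      exact (InnerProductSpace.Core.inner_zero_right (𝕜 := 𝕜) (F := A) _).symm
  | add b c hb hc =>
    have h := fun x y => InnerProductSpace.Core.inner_add_right (𝕜 := 𝕜) (F := A) a x y
    rw [map_add]
    refine (h _ _).trans (Eq.trans ?_ (h _ _).symm)
    exact congrArg₂ (· + ·) hb hc

/-- Degree `m ≠ n - 1` components `c` of `𝔡* b`, `b ∈ Aⁿ`, vanish, since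
`⟨c, c⟩ = ⟨c, 𝔡* b⟩ = ⟨𝔡 c, b⟩ = 0`. -/
theorem dStar_mem {n : ℤ} {b : A} (hb : b ∈ X.grade n) : X.dStar b ∈ X.grade (n + -1) := by
  refine X.mem_grade_of_component fun m hm => ?_
  apply X.metric.definite
  rw [← X.inner_eq_inner_component (X.component_mem _ _), ← X.adjoint]
  exact X.orthogonal (by omega) (X.d_mem (X.component_mem _ _)) hb

theorem laplacian_mem {n : ℤ} {a : A} (ha : a ∈ X.grade n) : X.laplacian a ∈ X.grade (n + 0) := by
  have h1 := X.d_mem (X.dStar_mem ha)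
  have h2 := X.dStar_mem (X.d_mem ha)
  rw [show n + -1 + 1 = n + 0 by ring] at h1
  rw [show n + 1 + -1 = n + 0 by ring] at h2
  exact Submodule.add_mem _ h1 h2

theorem component_laplacian (n : ℤ) (a : A) :
    X.component n (X.laplacian a) = X.laplacian (X.component n a) := by
  simpa using X.component_comm (f := X.laplacian) (fun _ _ h => X.laplacian_mem h) n a

theorem component_mem_harmonic {a : A} (ha : a ∈ X.harmonic) (n : ℤ) :
    X.component n a ∈ X.harmonic := by
  change X.laplacian _ = 0
  rw [← component_laplacian, show X.laplacian a = 0 from ha, map_zero]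

theorem component_mem_exactPart {a : A} (ha : a ∈ X.exactPart) (n : ℤ) :
    X.component n a ∈ X.exactPart := by
  obtain ⟨_, ⟨x, rfl⟩, _, ⟨y, rfl⟩, rfl⟩ := Submodule.mem_sup.1 ha
  have h1 := X.component_comm (f := X.d) (k := 1) (fun _ _ h => X.d_mem h) (n - 1) x
  have h2 := X.component_comm (f := X.dStar) (k := -1) (fun _ _ h => X.dStar_mem h) (n + 1) y
  rw [sub_add_cancel] at h1
  rw [add_neg_cancel_right] at h2
  rw [map_add, h1, h2]
  exact Submodule.add_mem_sup ⟨_, rfl⟩ ⟨_, rfl⟩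

theorem isInternal_harmonicGrade : DirectSum.IsInternal X.harmonicGrade := by
  rw [DirectSum.isInternal_submodule_iff_iSupIndep_and_iSup_eq_top]
  constructor
  · have h := ((DirectSum.isInternal_submodule_iff_iSupIndep_and_iSup_eq_top _).1
      X.isInternal).1
    rw [iSupIndep_def] at h ⊢
    intro n
    rw [Submodule.disjoint_def]
    intro a ha ha'
    refine Subtype.ext (Submodule.disjoint_def.1 (h n) (a : A) ha ?_)
    have := Submodule.mem_map_of_mem (f := X.harmonic.subtype) ha'
    simp only [Submodule.map_iSup] at this
    have hle : ⨆ m, ⨆ (_ : m ≠ n), (X.harmonicGrade m).map X.harmonic.subtype ≤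
        ⨆ m, ⨆ (_ : m ≠ n), X.grade m := iSup₂_mono fun m _ => Submodule.map_comap_le _ _
    exact hle this
  · rw [eq_top_iff]
    rintro ⟨a, ha⟩ -
    obtain ⟨s, hs⟩ := X.exists_eq_sum_component a
    have hs' : (⟨a, ha⟩ : X.harmonic) =
        ∑ n ∈ s, ⟨X.component n a, X.component_mem_harmonic ha n⟩ :=
      Subtype.ext (by simpa using hs)
    rw [hs']
    refine Submodule.sum_mem _ fun n _ => Submodule.mem_iSup_of_mem n ?_
    exact X.component_mem n a

variable {X}

theorem exists_harmonic_add_laplacian (hX : X.HasHodgeDecomposition) (a : A) :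
    ∃ h ∈ X.harmonic, ∃ w ∈ X.exactPart, a = h + X.laplacian w := by
  have ht : a ∈ X.harmonic ⊔ X.exactPart := by rw [hX.isCompl.sup_eq_top]; trivial
  obtain ⟨h, hh, r, hr, rfl⟩ := Submodule.mem_sup.1 ht
  obtain ⟨w, hw⟩ := hX.laplacianExact_bijective.2 ⟨r, hr⟩
  exact ⟨h, hh, w, w.2, by rw [← show X.laplacian w = r from congrArg Subtype.val hw]⟩

variable (hX : X.HasHodgeDecomposition)

theorem harmonicPart_add_exact {h r : A} (hh : h ∈ X.harmonic) (hr : r ∈ X.exactPart) :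
    (harmonicPart hX (h + r) : A) = h := by
  rw [harmonicPart, map_add, Submodule.projectionOnto_apply_of_mem_left _ hh,
    Submodule.projectionOnto_apply_of_mem_right _ hr, add_zero]

/-- Green's operator sends `h + □ w` to `w`, for `h` harmonic and `w ∈ Im 𝔡 ⊕ Im 𝔡*`. -/
theorem green_add_laplacian {h w : A} (hh : h ∈ X.harmonic) (hw : w ∈ X.exactPart) :
    green hX (h + X.laplacian w) = w := by
  simp only [green, LinearMap.comp_apply, map_add,
    Submodule.projectionOnto_apply_of_mem_right _ hh,
    Submodule.projectionOnto_apply_of_mem_left _ (laplacian_mem_exactPart w)]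
  have : (⟨X.laplacian w, laplacian_mem_exactPart w⟩ : X.exactPart)
      = LinearEquiv.ofBijective X.laplacianExact hX.laplacianExact_bijective ⟨w, hw⟩ := rfl
  rw [this]
  simp

theorem green_d (a : A) : green hX (X.d a) = X.d (green hX a) := by
  obtain ⟨h, hh, w, hw, rfl⟩ := exists_harmonic_add_laplacian hX a
  have hd : X.d (h + X.laplacian w) = 0 + X.laplacian (X.d w) := by
    simp only [map_add, laplacian_apply, X.d_d, ((X.mem_harmonic_iff h).1 hh).1, map_zero, zero_add,
      add_zero]
  rw [hd, green_add_laplacian hX (Submodule.zero_mem _)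
    (Submodule.mem_sup_left ⟨_, rfl⟩), green_add_laplacian hX hh hw]

theorem green_mem {n : ℤ} {a : A} (ha : a ∈ X.grade n) : green hX a ∈ X.grade n := by
  refine X.mem_grade_of_component fun m hm => ?_
  obtain ⟨h, hh, w, hw, rfl⟩ := exists_harmonic_add_laplacian hX a
  rw [green_add_laplacian hX hh hw]
  have h1 := X.component_of_ne hm ha
  rw [map_add, component_laplacian] at h1
  rw [← green_add_laplacian hX (X.component_mem_harmonic hh m) (X.component_mem_exactPart hw m),
    h1, map_zero]

theorem hodgeHomotopy_mem {n : ℤ} {a : A} (ha : a ∈ X.grade n) :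
    hodgeHomotopy hX a ∈ X.grade (n + -1) :=
  green_mem hX (X.dStar_mem ha)

/-- The homotopy formula: `1 - [𝔡, Q]` is the harmonic projection. -/
theorem sub_bracket_hodgeHomotopy (a : A) :
    a - (X.d (hodgeHomotopy hX a) + hodgeHomotopy hX (X.d a)) = harmonicPart hX a := by
  obtain ⟨h, hh, w, hw, rfl⟩ := exists_harmonic_add_laplacian hX a
  rw [harmonicPart_add_exact hX hh (laplacian_mem_exactPart w)]
  have h1 : X.d (hodgeHomotopy hX (h + X.laplacian w)) +
      hodgeHomotopy hX (X.d (h + X.laplacian w)) =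
      green hX (0 + X.laplacian (X.laplacian w)) := by
    have h0 : X.laplacian h = 0 := hh
    change X.d (green hX _) + green hX _ = _
    rw [← green_d, ← map_add, ← laplacian_apply, map_add, h0]
  rw [h1, green_add_laplacian hX (Submodule.zero_mem _) (laplacian_mem_exactPart w),
    add_sub_cancel_right]

theorem isMerkulovDatum_harmonic :
    IsMerkulovDatum X.toDGAlgebra X.harmonic (hodgeHomotopy hX) where
  d_mem w hw := by
    rw [((X.mem_harmonic_iff w).1 hw).1]
    exact Submodule.zero_mem _
  Q_degree _ _ hv := hodgeHomotopy_mem hX hv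
  proj_mem v := by
    rw [sub_bracket_hodgeHomotopy]
    exact Subtype.prop _

end MetricDGAlgebra

/-! ### Sums over the splittings of a word -/

section SplitSum

variable {α B C : Type*} [AddCommGroup B] [AddCommGroup C]

/-- The sum of `φ u v` over all ways of writing a word as a concatenation `u ++ v`; the pieces may
be empty. -/
def splitSum (φ : List α → List α → B) : List α → B
  | [] => φ [] []
  | a :: w => φ [] (a :: w) + splitSum (fun u v => φ (a :: u) v) w

theorem splitSum_congr {φ ψ : List α → List α → B} {w : List α}
    (h : ∀ u v, u ++ v = w → φ u v = ψ u v) : splitSum φ w = splitSum ψ w := by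
  induction w generalizing φ ψ with
  | nil => exact h _ _ rfl
  | cons a w ih =>
    rw [splitSum, splitSum, h _ _ rfl]
    congr 1
    exact ih fun u v huv => h _ _ (by rw [List.cons_append, huv])

theorem splitSum_add (φ ψ : List α → List α → B) (w : List α) :
    splitSum (fun u v => φ u v + ψ u v) w = splitSum φ w + splitSum ψ w := by
  induction w generalizing φ ψ with
  | nil => rfl
  | cons a w ih => rw [splitSum, splitSum, splitSum, ih]; abel

theorem map_splitSum {F : Type*} [FunLike F B C] [AddMonoidHomClass F B C] (f : F)
    (φ : List α → List α → B) (w : List α) :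
    f (splitSum φ w) = splitSum (fun u v => f (φ u v)) w := by
  induction w generalizing φ with
  | nil => rfl
  | cons a w ih => rw [splitSum, splitSum, map_add, ih]

theorem splitSum_zero (w : List α) : splitSum (fun _ _ => (0 : B)) w = 0 := by
  induction w with
  | nil => rfl
  | cons a w ih => rw [splitSum, ih, add_zero]

theorem splitSum_eq_sum (φ : List α → List α → B) (w : List α) :
    splitSum φ w = ∑ i ∈ Finset.range (w.length + 1), φ (w.take i) (w.drop i) := by
  induction w generalizing φ with
  | nil => simp [splitSum]
  | cons a w ih =>
    rw [splitSum, ih, List.length_cons, Finset.sum_range_succ' _ (w.length + 1), add_comm]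
    rfl

theorem splitSum_comm (φ : List α → List α → List α → List α → B) (w w' : List α) :
    splitSum (fun u v => splitSum (fun u' v' => φ u v u' v') w') w =
      splitSum (fun u' v' => splitSum (fun u v => φ u v u' v') w) w' := by
  simp only [splitSum_eq_sum]
  exact Finset.sum_comm

/-- Both sides sum over the ways of cutting a word into three pieces. -/
theorem splitSum_assoc (φ : List α → List α → List α → B) (w : List α) :
    splitSum (fun u v => splitSum (fun x y => φ x y v) u) w =
      splitSum (fun u v => splitSum (fun x y => φ u x y) v) w := by
  induction w generalizing φ with
  | nil => rfl
  | cons a w ih =>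
    simp only [splitSum]
    rw [splitSum_add, ih]
    abel

/-- Splittings of `u ++ y :: v` cut either inside `u`, before `y`, or after `y`, inside `v`. -/
theorem splitSum_append_cons (φ : List α → List α → B) (u : List α) (y : α) (v : List α) :
    splitSum φ (u ++ y :: v) =
      splitSum (fun u₁ u₂ => φ u₁ (u₂ ++ y :: v)) u +
        splitSum (fun v₁ v₂ => φ (u ++ y :: v₁) v₂) v := by
  induction u generalizing φ with
  | nil => rfl
  | cons a u ih => simp only [List.cons_append, splitSum, ih]; abel

theorem splitSum_map (s : α → α) (φ : List α → List α → B) (w : List α) :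
    splitSum φ (w.map s) = splitSum (fun u v => φ (u.map s) (v.map s)) w := by
  induction w generalizing φ with
  | nil => rfl
  | cons a w ih => simp only [List.map_cons, splitSum, ih, List.map_nil]

theorem splitSum_eq_of_cons {φ : List α → List α → B} (h : ∀ u a v, φ u (a :: v) = 0)
    (w : List α) : splitSum φ w = φ w [] := by
  induction w generalizing φ with
  | nil => rfl
  | cons a w ih => rw [splitSum, h, zero_add, ih fun u b v => h _ _ _]

/-- The sum of `F (s u ++ b x :: v)` over all ways of writing a word as `u ++ x ++ v`: insertion of
the operation `b` into `F`, with the Koszul sign `s` on the letters to its left. -/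
def insertSum (s : α → α) (b : List α → α) (F : List α → B) (w : List α) : B :=
  splitSum (fun u y => splitSum (fun x v => F (u.map s ++ b x :: v)) y) w

variable (s : α → α) (b : List α → α)

theorem insertSum_add (F G : List α → B) (w : List α) :
    insertSum s b (fun u => F u + G u) w = insertSum s b F w + insertSum s b G w := by
  simp only [insertSum, splitSum_add]

theorem map_insertSum {F : Type*} [FunLike F B C] [AddMonoidHomClass F B C] (f : F)
    (φ : List α → B) (w : List α) :
    f (insertSum s b φ w) = insertSum s b (fun u => f (φ u)) w := by
  simp only [insertSum, map_splitSum]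

/-- Insertion is a coderivation of the deconcatenation of words. -/
theorem insertSum_splitSum (φ : List α → List α → B) (w : List α) :
    insertSum s b (splitSum φ) w =
      splitSum (fun u v => insertSum s b (fun u' => φ u' v) u) w +
        splitSum (fun u v => insertSum s b (fun v' => φ (u.map s) v') v) w := by
  have h : ∀ u x v, splitSum φ (u.map s ++ b x :: v) =
      splitSum (fun v₁ v₂ => φ (u.map s ++ b x :: v₁) v₂) v +
        splitSum (fun u₁ u₂ => φ (u₁.map s) (u₂.map s ++ b x :: v)) u := by
    intro u x v
    rw [splitSum_append_cons, splitSum_map, add_comm]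
  simp only [insertSum, h, splitSum_add]
  congr 1
  · rw [splitSum_assoc (fun u y v => splitSum (fun x v₁ => φ (u.map s ++ b x :: v₁) v) y)]
    refine splitSum_congr fun u y _ => ?_
    exact (splitSum_assoc (fun x v₁ v₂ => φ (u.map s ++ b x :: v₁) v₂) y).symm
  · rw [← splitSum_assoc (fun u₁ u₂ y =>
      splitSum (fun x v => φ (u₁.map s) (u₂.map s ++ b x :: v)) y)]
    refine splitSum_congr fun u y _ => ?_
    rw [splitSum_comm]

end SplitSum

/-! ### The transferred operations in bar form -/

namespace DGAlgebra

variable {𝕜 A : Type*} [Field 𝕜] [NonUnitalRing A] [Module 𝕜 A]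
  (X : DGAlgebra 𝕜 A) (H : A →ₗ[𝕜] A)

/-- The components `f_n` of the transferred `A∞`-morphism, as one function on words:
`f₁ = id` and `f_n = H ∑ ε(f_k) f_l`, the sum being over `k + l = n`, `k, l ≥ 1`. -/
noncomputable def transfer : List A → A
  | [] => 0
  | [a] => a
  | a :: b :: w => H (∑ i : Fin (w.length + 1),
      X.parity (transfer ((a :: b :: w).take (i + 1))) * transfer ((a :: b :: w).drop (i + 1)))
termination_by w => w.length
decreasing_by all_goals simp <;> omega

/-- Merkulov's maps in bar form, where no signs depend on the positions:
`λ(w) = ∑ ε(f u) f v` over all `w = u ++ v`. -/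
noncomputable def barLambda : List A → A :=
  splitSum fun u v => X.parity (transfer X H u) * transfer X H v

/-- The word function that is the identity on words of length one and vanishes on others. -/
def letter : List A → A
  | [a] => a
  | _ => 0

theorem transfer_nil : transfer X H [] = 0 := by rw [transfer]

theorem barLambda_nil : barLambda X H [] = 0 := by
  rw [barLambda, splitSum, transfer_nil, mul_zero]

theorem barLambda_singleton (a : A) : barLambda X H [a] = 0 := by
  simp [barLambda, splitSum, transfer_nil]

theorem transfer_eq (w : List A) : transfer X H w = H (barLambda X H w) + letter w := by
  match w with
  | [] => simp [transfer_nil, barLambda_nil, letter]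
  | [a] => simp [transfer, barLambda_singleton, letter]
  | a :: b :: w =>
    rw [transfer, letter, add_zero, barLambda, splitSum_eq_sum, List.length_cons, List.length_cons,
      Finset.sum_range_succ, Finset.sum_range_succ', Finset.sum_range]
    · simp [transfer_nil]
    · simp

theorem transfer_eq_of_two_le {w : List A} (hw : 2 ≤ w.length) :
    transfer X H w = H (barLambda X H w) := by
  match w, hw with
  | a :: b :: w, _ => simp [transfer_eq, letter]

section Linear

variable [IsScalarTower 𝕜 A A] [SMulCommClass 𝕜 A A]

/-- Linearity of `f` and `λ` in each letter, proved together by induction on the length. -/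
theorem transfer_linear (n : ℕ) : ∀ (u v : List A), u.length + v.length < n →
    ∀ (c : 𝕜) (x y : A), transfer X H (u ++ (c • x + y) :: v) =
      c • transfer X H (u ++ x :: v) + transfer X H (u ++ y :: v) ∧
    barLambda X H (u ++ (c • x + y) :: v) =
      c • barLambda X H (u ++ x :: v) + barLambda X H (u ++ y :: v) := by
  induction n with
  | zero => intro u v h; omega
  | succ n ih =>
    intro u v huv c x y
    have hlam : barLambda X H (u ++ (c • x + y) :: v) =
        c • barLambda X H (u ++ x :: v) + barLambda X H (u ++ y :: v) := by
      simp only [barLambda, splitSum_append_cons, smul_add]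
      rw [add_add_add_comm]
      have hsmul : ∀ b : A, c • b = LinearMap.lsmul 𝕜 A c b := fun _ => rfl
      simp only [hsmul (splitSum _ _), map_splitSum, ← splitSum_add]
      simp only [LinearMap.lsmul_apply]
      congr 1
      · refine splitSum_congr fun u₁ u₂ hu => ?_
        match u₁, hu with
        | [], _ => simp [transfer_nil]
        | a :: u₁, hu =>
          have hl := congrArg List.length hu
          simp only [List.length_append, List.length_cons] at hl
          rw [(ih u₂ v (by omega) c x y).1, mul_add, mul_smul_comm]
      · refine splitSum_congr fun v₁ v₂ hv => ?_
        match v₂, hv with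
        | [], _ => simp [transfer_nil]
        | a :: v₂, hv =>
          have hl := congrArg List.length hv
          simp only [List.length_append, List.length_cons] at hl
          rw [(ih u v₁ (by omega) c x y).1, map_add, map_smul, add_mul, smul_mul_assoc]
    refine ⟨?_, hlam⟩
    have hletter : letter (u ++ (c • x + y) :: v) =
        c • letter (u ++ x :: v) + letter (u ++ y :: v) := by
      match u, v with
      | [], [] => rfl
      | [], _ :: _ => simp [letter]
      | _ :: [], _ => simp [letter]
      | _ :: _ :: _, _ => simp [letter]
    rw [transfer_eq, transfer_eq, transfer_eq, hlam, hletter, map_add, map_smul, smul_add]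
    abel

theorem barLambda_linear (u v : List A) (c : 𝕜) (x y : A) :
    barLambda X H (u ++ (c • x + y) :: v) =
      c • barLambda X H (u ++ x :: v) + barLambda X H (u ++ y :: v) :=
  (transfer_linear X H _ u v (Nat.lt_succ_self _) c x y).2

theorem barLambda_smul (u v : List A) (c : 𝕜) (x : A) :
    barLambda X H (u ++ (c • x) :: v) = c • barLambda X H (u ++ x :: v) := by
  -- the case `c = -1`, `x = y = 0` shows that a zero letter gives zero
  have h0 := barLambda_linear X H u v (-1) 0 0
  have h1 := barLambda_linear X H u v c x 0
  simp only [smul_zero, add_zero, neg_smul, one_smul, neg_add_cancel] at h0 h1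
  rw [h1, h0, add_zero]

end Linear

variable {H}

/-- For the shifted sign `-ε`, the functions `f` and `λ` have degrees `0` and `1`. -/
theorem transfer_barLambda_map_parity (hH : ∀ a, X.parity (H a) = -H (X.parity a)) (n : ℕ) :
    ∀ w : List A, w.length < n →
      transfer X H (w.map fun a => -X.parity a) = -X.parity (transfer X H w) ∧
      barLambda X H (w.map fun a => -X.parity a) = X.parity (barLambda X H w) := by
  induction n with
  | zero => intro w h; omega
  | succ n ih =>
    intro w hw
    have hlam : barLambda X H (w.map fun a => -X.parity a) = X.parity (barLambda X H w) := by
      rw [barLambda, splitSum_map, map_splitSum]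
      refine splitSum_congr fun u v huv => ?_
      have hl := congrArg List.length huv
      rw [List.length_append] at hl
      match u, v, hl with
      | [], v, _ => simp [transfer_nil]
      | _, [], _ => simp [transfer_nil]
      | a :: u, c :: v, hl =>
        simp only [List.length_cons] at hl
        rw [(ih (a :: u) (by simp; omega)).1, (ih (c :: v) (by simp; omega)).1,
          map_neg, neg_mul_neg, parity_mul]
    refine ⟨?_, hlam⟩
    rw [transfer_eq, transfer_eq, hlam, map_add, hH]
    match w with
    | [] => simp [letter]
    | [a] => simp [letter, add_comm]
    | _ :: _ :: _ => simp [letter]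

theorem transfer_map_parity (hH : ∀ a, X.parity (H a) = -H (X.parity a)) (w : List A) :
    transfer X H (w.map fun a => -X.parity a) = -X.parity (transfer X H w) :=
  (transfer_barLambda_map_parity X hH _ w (Nat.lt_succ_self _)).1

/-! ### The Stasheff identities in bar form -/

variable (H) in
/-- The transferred operations `b = (1 + dH + Hd) λ` in bar form. -/
noncomputable def barOp (w : List A) : A :=
  barLambda X H w + (X.d (H (barLambda X H w)) + H (X.d (barLambda X H w)))

variable (H) in
/-- Insertion of the transferred operations into a word function. -/
noncomputable def barInsert (F : List A → A) (w : List A) : A :=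
  insertSum (fun a => -X.parity a) (barOp X H) F w

theorem barInsert_letter (w : List A) : barInsert X H letter w = barOp X H w := by
  have h0 : ∀ w, splitSum (fun x v => letter (barOp X H x :: v)) w = barOp X H w := fun w =>
    splitSum_eq_of_cons (fun _ _ _ => rfl) w
  cases w with
  | nil => rfl
  | cons a w =>
    rw [barInsert, insertSum, splitSum]
    refine (congrArg₂ (· + ·) (h0 _) ?_).trans (add_zero _)
    refine (splitSum_congr fun u y _ => ?_).trans (splitSum_zero w)
    refine (splitSum_congr fun x v _ => ?_).trans (splitSum_zero y)
    cases u <;> rfl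

theorem barInsert_transfer (w : List A) :
    barInsert X H (transfer X H) w = H (barInsert X H (barLambda X H) w) + barOp X H w := by
  rw [← barInsert_letter, barInsert, funext (transfer_eq X H), insertSum_add, barInsert,
    map_insertSum]
  rfl

/-- Associativity of the product makes the quadratic terms cancel. -/
theorem splitSum_barLambda_mul (w : List A) :
    splitSum (fun u v => X.parity (barLambda X H u) * transfer X H v) w =
      splitSum (fun u v => transfer X H u * barLambda X H v) w := by
  have h1 : ∀ u v, X.parity (barLambda X H u) * transfer X H v =
      splitSum (fun x y => transfer X H x * X.parity (transfer X H y) * transfer X H v) u := by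
    intro u v
    rw [barLambda, map_splitSum,
      show ∀ a b : A, a * b = AddMonoidHom.mulRight b a from fun _ _ => rfl, map_splitSum]
    refine splitSum_congr fun x y _ => ?_
    simp only [AddMonoidHom.mulRight_apply, parity_mul, parity_parity]
  have h2 : ∀ u v, transfer X H u * barLambda X H v =
      splitSum (fun x y => transfer X H u * X.parity (transfer X H x) * transfer X H y) v := by
    intro u v
    rw [barLambda, show ∀ a b : A, a * b = AddMonoidHom.mulLeft a b from fun _ _ => rfl,
      map_splitSum]
    refine splitSum_congr fun x y _ => ?_
    simp only [AddMonoidHom.coe_mulLeft, mul_assoc]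
  simp only [h1, h2]
  exact splitSum_assoc
    (fun x y v => transfer X H x * X.parity (transfer X H y) * transfer X H v) w

/-- `λ ◁ b` in terms of `f ◁ b`: insertion passes to the two factors of `λ`. -/
theorem barInsert_barLambda (hH : ∀ a, X.parity (H a) = -H (X.parity a)) (w : List A) :
    barInsert X H (barLambda X H) w =
      splitSum (fun u v => X.parity (barInsert X H (transfer X H) u) * transfer X H v) w -
        splitSum (fun u v => transfer X H u * barInsert X H (transfer X H) v) w := by
  rw [barInsert, barLambda, insertSum_splitSum, sub_eq_add_neg]
  congr 1
  · refine splitSum_congr fun u v _ => ?_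
    rw [barInsert, map_insertSum,
      show ∀ a b : A, a * b = AddMonoidHom.mulRight b a from fun _ _ => rfl, map_insertSum]
    rfl
  · rw [show ∀ a : A, -a = negAddMonoidHom a from fun _ => rfl, map_splitSum]
    refine splitSum_congr fun u v _ => ?_
    rw [barInsert, show ∀ a b : A, a * b = AddMonoidHom.mulLeft a b from fun _ _ => rfl,
      map_insertSum, map_insertSum]
    simp only [transfer_map_parity X hH, map_neg, parity_parity, AddMonoidHom.coe_mulLeft,
      negAddMonoidHom_apply, neg_mul]

/-- On closed letters, `d λ` is minus the insertion of the transferred operations into `λ`.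
Equivalently, `d f + λ` is their insertion into `f`, i.e. `f` is an `A∞`-morphism; the two forms
are proved together by induction on the length of the word. -/
theorem d_barLambda (hH : ∀ a, X.parity (H a) = -H (X.parity a)) (n : ℕ) :
    ∀ w : List A, w.length < n → (∀ a ∈ w, X.d a = 0) →
      X.d (barLambda X H w) = -barInsert X H (barLambda X H) w ∧
      X.d (transfer X H w) = barInsert X H (transfer X H) w - barLambda X H w := by
  induction n with
  | zero => intro w h; omega
  | succ n ih =>
    intro w hw hd
    have hlam : X.d (barLambda X H w) = -barInsert X H (barLambda X H) w := by
      have hterm : X.d (barLambda X H w) = splitSum (fun u v =>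
          (X.parity (barLambda X H u) * transfer X H v +
              -(transfer X H u * barLambda X H v)) +
            (-(X.parity (barInsert X H (transfer X H) u) * transfer X H v) +
              transfer X H u * barInsert X H (transfer X H) v)) w := by
        change X.d (splitSum (fun u v => X.parity (transfer X H u) * transfer X H v) w) = _
        rw [map_splitSum]
        refine splitSum_congr fun u v huv => ?_
        have hl := congrArg List.length huv
        rw [List.length_append] at hl
        match u, v, hl, huv with
        | [], v, _, _ => simp [transfer_nil, barLambda_nil, barInsert, insertSum, splitSum,
            barOp, transfer]
        | u, [], _, _ => simp [transfer_nil, barLambda_nil, barInsert, insertSum, splitSum,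
            barOp, transfer]
        | a :: u, c :: v, hl, huv =>
          simp only [List.length_cons] at hl
          have hu := (ih (a :: u) (by simp; omega)
            fun x hx => hd x (huv ▸ List.mem_append_left _ hx)).2
          have hv := (ih (c :: v) (by simp; omega)
            fun x hx => hd x (huv ▸ List.mem_append_right _ hx)).2
          rw [d_mul, parity_parity, ← neg_eq_iff_eq_neg.2 (X.parity_d (transfer X H (a :: u))),
            hu, hv, map_sub, neg_sub, sub_mul, mul_sub]
          abel
      rw [hterm, barInsert_barLambda X hH]
      simp only [splitSum_add]
      simp only [show ∀ a : A, -a = negAddMonoidHom a from fun _ => rfl, ← map_splitSum]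
      simp only [negAddMonoidHom_apply, splitSum_barLambda_mul]
      abel
    refine ⟨hlam, ?_⟩
    have hletter : X.d (letter w) = 0 := by
      match w, hd with
      | [], _ => exact map_zero _
      | [a], hd => exact hd a (by simp)
      | _ :: _ :: _, _ => exact map_zero _
    rw [barInsert_transfer, transfer_eq, map_add, hletter, barOp, hlam, map_neg]
    abel

/-- The Stasheff identities in bar form. -/
theorem barInsert_barOp (hH : ∀ a, X.parity (H a) = -H (X.parity a))
    (hP : ∀ a, X.d (a + (X.d (H a) + H (X.d a))) = 0) (w : List A) (hd : ∀ a ∈ w, X.d a = 0) :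
    barInsert X H (barOp X H) w = 0 := by
  let P : A →ₗ[𝕜] A := LinearMap.id + (X.d ∘ₗ H + H ∘ₗ X.d)
  have h1 : barInsert X H (barOp X H) w = P (barInsert X H (barLambda X H) w) := by
    rw [barInsert, barInsert, map_insertSum]
    rfl
  have h2 := (d_barLambda X hH _ w (Nat.lt_succ_self _) hd).1
  rw [h1, ← neg_eq_iff_eq_neg.2 h2, map_neg, neg_eq_zero]
  have h3 := hP (barLambda X H w)
  simp only [map_add, X.d_d, zero_add] at h3
  change _ + (X.d (H (X.d _)) + H (X.d (X.d _))) = 0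
  rw [X.d_d, map_zero, add_zero]
  exact h3

end DGAlgebra

/-! ### Words given by initial segments of sequences -/

/-- The word formed by the first `n` terms of a sequence. -/
def initialWord {α : Type*} (n : ℕ) (v : ℕ → α) : List α := (List.range n).map v

section InitialWord

variable {α : Type*}

@[simp] theorem length_initialWord (n : ℕ) (v : ℕ → α) : (initialWord n v).length = n := by
  simp [initialWord]

@[simp] theorem getElem_initialWord (n : ℕ) (v : ℕ → α) (i : ℕ) (h : i < (initialWord n v).length) :
    (initialWord n v)[i] = v i := by
  simp [initialWord]

theorem initialWord_congr {n : ℕ} {v w : ℕ → α} (h : ∀ i < n, v i = w i) :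
    initialWord n v = initialWord n w :=
  List.map_congr_left fun i hi => h i (List.mem_range.1 hi)

theorem ofFn_eq_initialWord (n : ℕ) (v : ℕ → α) :
    List.ofFn (fun i : Fin n => v i) = initialWord n v :=
  List.ext_getElem (by simp) (by simp)

theorem ofFn_update {k : ℕ} [DecidableEq (Fin k)] (v : Fin k → α) (i : Fin k) (x : α) :
    List.ofFn (Function.update v i x) =
      (List.ofFn v).take i ++ x :: (List.ofFn v).drop (i + 1) := by
  rw [← List.set_eq_take_cons_drop x (by simp)]
  refine List.ext_getElem (by simp) fun j h1 h2 => ?_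
  simp only [List.getElem_ofFn, List.getElem_set, Function.update_apply, Fin.ext_iff, eq_comm]

theorem take_initialWord {n i : ℕ} (h : i ≤ n) (v : ℕ → α) :
    (initialWord n v).take i = initialWord i v :=
  List.ext_getElem (by simp [h]) (by simp)

theorem drop_initialWord (n i : ℕ) (v : ℕ → α) :
    (initialWord n v).drop i = initialWord (n - i) fun k => v (i + k) :=
  List.ext_getElem (by simp) (by simp)

theorem initialWord_append_cons (j t : ℕ) (v : ℕ → α) (y : α) (v' : ℕ → α) :
    initialWord j v ++ y :: initialWord t v' =
      initialWord (j + 1 + t) fun i => if i < j then v i else if i = j then y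
        else v' (i - j - 1) := by
  refine List.ext_getElem (by simp; omega) fun i h1 h2 => ?_
  rw [List.getElem_append]
  simp only [length_initialWord, getElem_initialWord, List.getElem_cons]
  by_cases h : i < j
  · simp [h]
  · by_cases h' : i = j
    · simp [h']
    · simp [h, h', show i - j ≠ 0 by omega]

theorem splitSum_initialWord {B : Type*} [AddCommGroup B] (φ : List α → List α → B) (n : ℕ)
    (v : ℕ → α) :
    splitSum φ (initialWord n v) = ∑ i ∈ Finset.range (n + 1),
      φ (initialWord i v) (initialWord (n - i) fun k => v (i + k)) := by
  rw [splitSum_eq_sum, length_initialWord]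
  refine Finset.sum_congr rfl fun i hi => ?_
  rw [take_initialWord (Nat.lt_succ_iff.1 (Finset.mem_range.1 hi)), drop_initialWord]

end InitialWord

/-! ### Signs -/

theorem negOnePow_sum {ι : Type*} (s : Finset ι) (f : ι → ℤ) :
    (∑ i ∈ s, f i).negOnePow = ∏ i ∈ s, (f i).negOnePow := by
  classical
  induction s using Finset.induction_on with
  | empty => simp
  | insert a s ha ih => rw [Finset.sum_insert ha, Finset.prod_insert ha, Int.negOnePow_add, ih]

theorem negOnePow_congr {a b : ℤ} (c : ℤ) (h : a - b = 2 * c) : a.negOnePow = b.negOnePow :=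
  (Int.negOnePow_eq_iff a b).2 ⟨c, by omega⟩

/-- The exponent `∑ (n - 1 - i) eᵢ` of the sign that compares Merkulov's operations on `n` elements
of degrees `e₀, …, e_{n-1}` with their bar form. -/
def barExponent (n : ℕ) (e : ℕ → ℤ) : ℤ :=
  ∑ i ∈ Finset.range n, ((n : ℤ) - 1 - i) * e i

theorem barExponent_add (k l : ℕ) (e : ℕ → ℤ) :
    barExponent (k + l) e = barExponent k e + l * ∑ i ∈ Finset.range k, e i +
      barExponent l fun i => e (k + i) := by
  simp only [barExponent, Finset.sum_range_add, Finset.mul_sum, ← Finset.sum_add_distrib]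
  congr 1
  · exact Finset.sum_congr rfl fun i _ => by push_cast; ring
  · exact Finset.sum_congr rfl fun i _ => by push_cast; ring

theorem barExponent_one (e : ℕ → ℤ) : barExponent 1 e = 0 := by simp [barExponent]

theorem barExponent_congr {n : ℕ} {e e' : ℕ → ℤ} (h : ∀ i < n, e i = e' i) :
    barExponent n e = barExponent n e' :=
  Finset.sum_congr rfl fun i hi => by rw [h i (Finset.mem_range.1 hi)]

section UnitsSMul

theorem units_smul_mul_smul {A : Type*} [NonUnitalRing A] (u w : ℤˣ) (a b : A) :
    (u • a) * (w • b) = (u * w) • (a * b) := by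
  rcases Int.units_eq_one_or u with rfl | rfl <;> rcases Int.units_eq_one_or w with rfl | rfl <;>
    simp [Units.smul_def]

theorem map_units_smul {B C F : Type*} [AddCommGroup B] [AddCommGroup C] [FunLike F B C]
    [AddMonoidHomClass F B C] (f : F) (u : ℤˣ) (b : B) : f (u • b) = u • f b := by
  simp only [Units.smul_def, map_zsmul]

theorem MultilinearMap.map_units_smul_univ {𝕜 V W : Type*} [CommRing 𝕜] [AddCommGroup V]
    [Module 𝕜 V] [AddCommGroup W] [Module 𝕜 W] {k : ℕ}
    (f : MultilinearMap 𝕜 (fun _ : Fin k => V) W) (u : Fin k → ℤˣ) (v : Fin k → V) :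
    f (fun i => u i • v i) = (∏ i, u i) • f v := by
  have h := f.map_smul_univ (fun i => (((u i : ℤˣ) : ℤ) : 𝕜)) v
  simp only [Int.cast_smul_eq_zsmul] at h
  rw [← Int.cast_prod, Int.cast_smul_eq_zsmul] at h
  simp only [Units.smul_def, Units.coe_prod]
  exact h

end UnitsSMul

/-! ### Degrees and multilinearity of the bar operations -/

namespace DGAlgebra

variable {𝕜 A : Type*} [Field 𝕜] [NonUnitalRing A] [Module 𝕜 A]
  (X : DGAlgebra 𝕜 A) {H : A →ₗ[𝕜] A}

/-- In unshifted degrees, `f_n` has degree `1 - n` and `λ_n` has degree `2 - n`. -/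
theorem transfer_barLambda_mem (hH : ∀ n, ∀ a ∈ X.grade n, H a ∈ X.grade (n + -1)) (N : ℕ) :
    ∀ n < N, ∀ (e : ℕ → ℤ) (v : ℕ → A), (∀ i < n, v i ∈ X.grade (e i)) →
      transfer X H (initialWord n v) ∈ X.grade (∑ i ∈ Finset.range n, e i + 1 - n) ∧
      barLambda X H (initialWord n v) ∈ X.grade (∑ i ∈ Finset.range n, e i + 2 - n) := by
  induction N with
  | zero => intro n h; omega
  | succ N ih =>
    intro n hn e v hv
    have hlam : barLambda X H (initialWord n v) ∈
        X.grade (∑ i ∈ Finset.range n, e i + 2 - n) := by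
      rw [barLambda, splitSum_initialWord]
      refine Submodule.sum_mem _ fun i hi => ?_
      have hi' := Finset.mem_range.1 hi
      by_cases h0 : i = 0
      · subst h0
        simp [initialWord, transfer_nil]
      by_cases h1 : i = n
      · subst h1
        simp [initialWord, transfer_nil]
      have hu := (ih i (by omega) e v fun k hk => hv k (by omega)).1
      have hw := (ih (n - i) (by omega) (fun k => e (i + k)) (fun k => v (i + k))
        fun k hk => hv _ (by omega)).1
      have := X.mul_mem (X.units_smul_mem (∑ k ∈ Finset.range i, e k + 1 - (i : ℤ)).negOnePow hu) hw
      rw [← X.parity_of_mem hu] at this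
      obtain ⟨t, rfl⟩ : ∃ t, n = i + t := ⟨n - i, by omega⟩
      convert this using 2
      rw [Finset.sum_range_add, Nat.add_sub_cancel_left]
      push_cast
      ring
    refine ⟨?_, hlam⟩
    match n, hlam with
    | 0, _ => simp [initialWord, transfer_nil]
    | 1, _ => simpa [initialWord, transfer] using hv 0 one_pos
    | n + 2, hlam =>
      rw [transfer_eq_of_two_le X H (by simp)]
      convert hH _ _ hlam using 2
      ring

theorem parity_transfer (hH : ∀ n, ∀ a ∈ X.grade n, H a ∈ X.grade (n + -1)) {n : ℕ}
    {e : ℕ → ℤ} {v : ℕ → A} (hv : ∀ i < n, v i ∈ X.grade (e i)) :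
    X.parity (transfer X H (initialWord n v)) =
      (∑ i ∈ Finset.range n, e i + 1 - n).negOnePow • transfer X H (initialWord n v) :=
  X.parity_of_mem (transfer_barLambda_mem X hH _ n (Nat.lt_succ_self _) e v hv).1

theorem barLambda_mem (hH : ∀ n, ∀ a ∈ X.grade n, H a ∈ X.grade (n + -1)) {n : ℕ}
    {e : ℕ → ℤ} {v : ℕ → A} (hv : ∀ i < n, v i ∈ X.grade (e i)) :
    barLambda X H (initialWord n v) ∈ X.grade (∑ i ∈ Finset.range n, e i + 2 - n) :=
  (transfer_barLambda_mem X hH _ n (Nat.lt_succ_self _) e v hv).2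

theorem parity_pow_of_mem {n : ℤ} {a : A} (ha : a ∈ X.grade n) (p : ℕ) :
    (X.parity ^ p) a = (p * n).negOnePow • a := by
  induction p with
  | zero => simp
  | succ p ih =>
    rw [pow_succ', Module.End.mul_apply, ih, map_units_smul, X.parity_of_mem ha, smul_smul,
      ← Int.negOnePow_add]
    congr 2
    push_cast
    ring

variable (H) in
/-- Merkulov's map `λ_k` in bar form, as a multilinear map. -/
noncomputable def barMultilinear [IsScalarTower 𝕜 A A] [SMulCommClass 𝕜 A A] (k : ℕ) :
    MultilinearMap 𝕜 (fun _ : Fin k => A) A where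
  toFun v := barLambda X H (List.ofFn v)
  map_update_add' v i x y := by
    have h := barLambda_linear X H ((List.ofFn v).take i) ((List.ofFn v).drop (i + 1)) 1 x y
    simp only [ofFn_update]
    simpa only [one_smul] using h
  map_update_smul' v i c x := by
    simp only [ofFn_update]
    exact barLambda_smul X H _ _ c x

theorem barLambda_units_smul [IsScalarTower 𝕜 A A] [SMulCommClass 𝕜 A A] (k : ℕ) (u : ℕ → ℤˣ)
    (v : ℕ → A) :
    barLambda X H (initialWord k fun i => u i • v i) =
      (∏ i ∈ Finset.range k, u i) • barLambda X H (initialWord k v) := by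
  rw [← ofFn_eq_initialWord, ← ofFn_eq_initialWord, Finset.prod_range]
  exact (barMultilinear X H k).map_units_smul_univ (fun i => u i) (fun i => v i)

/-! ### Comparison with Merkulov's recursion -/

/-- Comparison of one term of Merkulov's recursion with the corresponding term of its bar form.
The boundary terms of the recursion fit the same pattern with the convention `Qλ₁ = -1`, since
`Q λ_k` corresponds to `-f_k` and `f₁ = 1`. -/
theorem sign_smul_transfer_mul_transfer (hH : ∀ n, ∀ a ∈ X.grade n, H a ∈ X.grade (n + -1))
    {k l : ℕ} {e : ℕ → ℤ} {v : ℕ → A} (hv : ∀ i < k, v i ∈ X.grade (e i)) :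
    (barExponent (k + l) e).negOnePow • (X.parity (transfer X H (initialWord k v)) *
        transfer X H (initialWord l fun i => v (k + i))) =
      ((k : ℤ) + 1 + (l - 1) * ∑ i ∈ Finset.range k, e i).negOnePow •
        (((barExponent k e).negOnePow • transfer X H (initialWord k v)) *
          ((barExponent l fun i => e (k + i)).negOnePow •
            transfer X H (initialWord l fun i => v (k + i)))) := by
  have h := units_smul_mul_smul (∑ i ∈ Finset.range k, e i + 1 - (k : ℤ)).negOnePow 1
    (transfer X H (initialWord k v)) (transfer X H (initialWord l fun i => v (k + i)))
  rw [one_smul, mul_one] at h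
  rw [parity_transfer X hH hv, h, units_smul_mul_smul, smul_smul, smul_smul]
  simp only [← Int.negOnePow_add]
  congr 1
  apply negOnePow_congr (∑ i ∈ Finset.range k, e i - k)
  rw [barExponent_add]
  ring

/-- Merkulov's maps agree with their bar form up to the sign `(-1)^(∑ (n - 1 - i) eᵢ)`. -/
theorem merkulovLambda_eq (Q : A →ₗ[𝕜] A)
    (hQ : ∀ n, ∀ a ∈ X.grade n, Q a ∈ X.grade (n + -1)) (N : ℕ) :
    ∀ n < N, 2 ≤ n → ∀ (e : ℕ → ℤ) (v : ℕ → A), (∀ i < n, v i ∈ X.grade (e i)) →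
      merkulovLambda Q n e v = (barExponent n e).negOnePow • barLambda X (-Q) (initialWord n v) := by
  have hH : ∀ n, ∀ a ∈ X.grade n, (-Q) a ∈ X.grade (n + -1) :=
    fun n a ha => Submodule.neg_mem _ (hQ n a ha)
  induction N with
  | zero => intro n h; omega
  | succ N ih =>
    intro n hn h2 e v hv
    have hone : ∀ v : ℕ → A, transfer X (-Q) (initialWord 1 v) = v 0 := fun v => by
      simp [initialWord, transfer]
    match n, hn, h2, hv with
    | 2, _, _, hv =>
      have h := sign_smul_transfer_mul_transfer X hH (k := 1) (l := 1) (e := e) (v := v)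
        fun i hi => hv i (by omega)
      rw [barLambda, splitSum_initialWord]
      simp only [Finset.sum_range_succ, Finset.sum_range_zero, initialWord, transfer_nil,
        List.range_zero, List.map_nil, map_zero, zero_mul, zero_add, Nat.sub_self, mul_zero,
        add_zero]
      refine Eq.trans ?_ h.symm
      simp [hone, barExponent_one, merkulovLambda, Int.negOnePow_even 2 even_two]
    | n + 3, hn, _, hv =>
      -- `Qλ_k` is minus the signed `f_k` for `k ≥ 2`, as `f = -Q λ` there.
      have hQL : ∀ k, 2 ≤ k → k < n + 3 → ∀ (e : ℕ → ℤ) (v : ℕ → A),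
          (∀ i < k, v i ∈ X.grade (e i)) → Q (merkulovLambda Q k e v) =
            -((barExponent k e).negOnePow • transfer X (-Q) (initialWord k v)) := by
        intro k hk hkn e v hv
        rw [ih k (by omega) hk e v hv, transfer_eq_of_two_le X (-Q) (by simpa using hk),
          map_units_smul, LinearMap.neg_apply, smul_neg, neg_neg]
      have hT := fun (k l : ℕ) (hk : k ≤ n + 3) =>
        sign_smul_transfer_mul_transfer X hH (k := k) (l := l) (e := e) (v := v)
          fun i hi => hv i (by omega)
      rw [merkulovLambda, barLambda, splitSum_initialWord, Finset.sum_range_succ,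
        Finset.sum_range_succ', Finset.sum_range_succ, Finset.sum_range_succ',
        show ∀ a, (barExponent (n + 3) e).negOnePow • a =
          DistribSMul.toAddMonoidHom A (barExponent (n + 3) e).negOnePow a from fun _ => rfl]
      simp only [map_add, map_sum]
      simp only [DistribSMul.toAddMonoidHom_apply]
      have e0 : transfer X (-Q) (initialWord 0 v) = 0 := transfer_nil X (-Q)
      have e1 : transfer X (-Q) (initialWord (n + 3 - (n + 3)) fun k => v (n + 3 + k)) = 0 := by
        rw [Nat.sub_self]; exact transfer_nil X (-Q)
      rw [e0, e1, map_zero, zero_mul, mul_zero, smul_zero, add_zero, add_zero]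
      have t1 := hT 1 (n + 2) (by omega)
      have t2 := hT (n + 2) 1 (by omega)
      rw [show 1 + (n + 2) = n + 3 by omega] at t1
      rw [show n + 2 + 1 = n + 3 by omega] at t2
      have s1 : n + 3 - (0 + 1) = n + 2 := by omega
      have s2 : n + 3 - (n + 1 + 1) = 1 := by omega
      rw [s1, s2, zero_add, t1, t2, hone, hone, barExponent_one, barExponent_one,
        Int.negOnePow_zero, one_smul, one_smul]
      have r1 := hQL (n + 2) (by omega) (by omega) e v fun i hi => hv i (by omega)
      have r2 := hQL (n + 2) (by omega) (by omega) (fun i => e (1 + i)) (fun i => v (1 + i))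
        fun i hi => hv _ (by omega)
      rw [r1, r2, Finset.sum_range]
      have c1 : (((n + 2 : ℕ) : ℤ) + 1 + (((1 : ℕ) : ℤ) - 1) *
          ∑ i ∈ Finset.range (n + 2), e i).negOnePow = -((n : ℤ) + 2).negOnePow := by
        rw [← Int.negOnePow_succ]
        congr 1
        push_cast
        ring
      have c2 : (((1 : ℕ) : ℤ) + 1 + (((n + 2 : ℕ) : ℤ) - 1) *
          ∑ i ∈ Finset.range 1, e i).negOnePow = (((n : ℤ) + 3) * e 0).negOnePow := by
        apply negOnePow_congr (1 - e 0)
        simp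
        ring
      have hsum : ∀ r : Fin n, (barExponent (n + 3) e).negOnePow •
          (X.parity (transfer X (-Q) (initialWord ((r : ℕ) + 1 + 1) v)) *
            transfer X (-Q) (initialWord (n + 3 - ((r : ℕ) + 1 + 1))
              fun k => v ((r : ℕ) + 1 + 1 + k))) =
          -((((r : ℤ) + 2) + ((n : ℤ) + 1 - r - 1) *
              ∑ i ∈ Finset.range ((r : ℕ) + 2), e i).negOnePow •
            (Q (merkulovLambda Q ((r : ℕ) + 2) e v) *
              Q (merkulovLambda Q (n + 1 - (r : ℕ))
                (fun i => e ((r : ℕ) + 2 + i)) (fun i => v ((r : ℕ) + 2 + i))))) := by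
        intro r
        have hr := r.2
        have t := hT (r + 2) (n + 1 - r) (by omega)
        rw [show (r : ℕ) + 2 + (n + 1 - r) = n + 3 by omega] at t
        rw [show n + 3 - ((r : ℕ) + 1 + 1) = n + 1 - r by omega,
          hQL (r + 2) (by omega) (by omega) e v fun i hi => hv i (by omega),
          hQL (n + 1 - r) (by omega) (by omega) _ _ fun i hi => hv _ (by omega), neg_mul_neg]
        refine t.trans ?_
        rw [← Units.neg_smul, ← Int.negOnePow_succ]
        congr 2
        rw [Nat.cast_sub (by omega)]
        push_cast
        ring
      rw [Finset.sum_congr rfl fun r _ => hsum r, Finset.sum_neg_distrib, c1, c2]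
      simp only [neg_mul, mul_neg, smul_neg, Units.neg_smul]
      abel

end DGAlgebra

/-! ### The transferred structure on harmonic elements -/

namespace MetricDGAlgebra

variable {𝕜 A : Type*} [RCLike 𝕜] [NonUnitalRing A] [Module 𝕜 A]
  {X : MetricDGAlgebra 𝕜 A} (hX : X.HasHodgeDecomposition)

theorem neg_hodgeHomotopy_mem (n : ℤ) (a : A) (ha : a ∈ X.grade n) :
    (-hodgeHomotopy hX) a ∈ X.grade (n + -1) :=
  Submodule.neg_mem _ (hodgeHomotopy_mem hX ha)

theorem parity_neg_hodgeHomotopy (a : A) :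
    X.parity ((-hodgeHomotopy hX) a) = -(-hodgeHomotopy hX) (X.parity a) :=
  X.parity_anticomm (k := -1) (by decide) (neg_hodgeHomotopy_mem hX) a

theorem barOp_neg_hodgeHomotopy (w : List A) :
    X.barOp (-hodgeHomotopy hX) w = harmonicPart hX (X.barLambda (-hodgeHomotopy hX) w) := by
  rw [← sub_bracket_hodgeHomotopy, DGAlgebra.barOp]
  simp only [LinearMap.neg_apply, map_neg]
  abel

theorem harmonicPart_mem {n : ℤ} {a : A} (ha : a ∈ X.grade n) :
    harmonicPart hX a ∈ X.harmonicGrade n := by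
  change (harmonicPart hX a : A) ∈ X.grade n
  rw [← sub_bracket_hodgeHomotopy]
  have h1 := X.d_mem (hodgeHomotopy_mem hX ha)
  have h2 := hodgeHomotopy_mem hX (X.d_mem ha)
  rw [neg_add_cancel_right] at h1
  rw [add_neg_cancel_right] at h2
  exact Submodule.sub_mem _ ha (Submodule.add_mem _ h1 h2)

theorem barOp_nil : X.barOp (-hodgeHomotopy hX) [] = 0 := by
  simp [DGAlgebra.barOp, DGAlgebra.barLambda_nil]

/-- The operations of a Merkulov structure are determined on homogeneous elements, hence
everywhere, since the harmonic space has a basis of homogeneous elements. -/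
theorem merkulovStructure_unique {M M' : AInfinityStructure 𝕜 X.harmonic X.harmonicGrade}
    (hM : IsMerkulovStructure X.toDGAlgebra X.harmonic (hodgeHomotopy hX) M)
    (hM' : IsMerkulovStructure X.toDGAlgebra X.harmonic (hodgeHomotopy hX) M') : M = M' := by
  have h : M.m = M'.m := by
    funext k
    match k with
    | 0 => rw [M.m_zero, M'.m_zero]
    | 1 =>
      ext v
      rw [show v = fun _ => v 0 from funext fun i => congrArg v (Subsingleton.elim _ _),
        hM.1, hM'.1]
    | k + 2 =>
      let b := X.isInternal_harmonicGrade.collectedBasis fun n =>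
        Module.Basis.ofVectorSpace 𝕜 (X.harmonicGrade n)
      refine Module.Basis.ext_multilinear (fun _ => b) fun v => Subtype.ext ?_
      let e : ℕ → ℤ := fun i => if h : i < k + 2 then (v ⟨i, h⟩).1 else 0
      let w : ℕ → X.harmonic := fun i => if h : i < k + 2 then b (v ⟨i, h⟩) else 0
      have hw : ∀ i < k + 2, w i ∈ X.harmonicGrade (e i) := by
        intro i hi
        simp only [w, e, dif_pos hi]
        exact X.isInternal_harmonicGrade.collectedBasis_mem _ _
      have hv : (fun i => b (v i)) = fun i : Fin (k + 2) => w i := by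
        funext i
        simp [w]
      rw [hv]
      exact (hM.2 _ (by omega) e w hw).trans (hM'.2 _ (by omega) e w hw).symm
  cases M
  cases M'
  congr

variable [IsScalarTower 𝕜 A A] [SMulCommClass 𝕜 A A]

/-- The operation `m_k` on harmonic elements. The powers of the parity involution encode, on all
elements, the sign `(-1)^(∑ (k - 1 - i) eᵢ)` that relates `λ_k` to its bar form. -/
noncomputable def harmonicOp (k : ℕ) :
    MultilinearMap 𝕜 (fun _ : Fin k => X.harmonic) X.harmonic :=
  (harmonicPart hX).compMultilinearMap
    ((X.barMultilinear (-hodgeHomotopy hX) k).compLinearMap fun i =>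
      (X.parity ^ (k - 1 - i : ℕ)) ∘ₗ X.harmonic.subtype)

theorem harmonicOp_apply {k : ℕ} {e : ℕ → ℤ} {w : ℕ → X.harmonic}
    (hw : ∀ i < k, w i ∈ X.harmonicGrade (e i)) :
    harmonicOp hX k (fun i => w i) = (barExponent k e).negOnePow •
      harmonicPart hX (X.barLambda (-hodgeHomotopy hX) (initialWord k fun i => (w i : A))) := by
  have h1 : harmonicOp hX k (fun i => w i) = harmonicPart hX (X.barLambda (-hodgeHomotopy hX)
      (initialWord k fun i => (((k : ℤ) - 1 - i) * e i).negOnePow • (w i : A))) := by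
    rw [← ofFn_eq_initialWord]
    have h2 : (fun i : Fin k => (((k : ℤ) - 1 - i) * e i).negOnePow • (w i : A)) =
        fun i : Fin k => (X.parity ^ (k - 1 - i : ℕ)) (w i : A) := by
      funext i
      have hi := i.2
      rw [X.parity_pow_of_mem (a := (w i : A)) (hw i hi), Nat.cast_sub (by omega),
        Nat.cast_sub (by omega), Nat.cast_one]
    exact congrArg (fun v => harmonicPart hX (X.barLambda (-hodgeHomotopy hX) (List.ofFn v)))
      h2.symm
  rw [h1, DGAlgebra.barLambda_units_smul, map_units_smul, barExponent, negOnePow_sum]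

theorem harmonicOp_mem {k : ℕ} {e : ℕ → ℤ} {w : ℕ → X.harmonic}
    (hw : ∀ i < k, w i ∈ X.harmonicGrade (e i)) :
    harmonicOp hX k (fun i => w i) ∈ X.harmonicGrade (∑ i ∈ Finset.range k, e i + 2 - k) := by
  rw [harmonicOp_apply hX hw]
  exact X.units_smul_mem (n := ∑ i ∈ Finset.range k, e i + 2 - k) _ (harmonicPart_mem hX
    (X.barLambda_mem (neg_hodgeHomotopy_mem hX) hw))

theorem barOp_units_smul (k : ℕ) (u : ℕ → ℤˣ) (v : ℕ → A) :
    X.barOp (-hodgeHomotopy hX) (initialWord k fun i => u i • v i) =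
      (∏ i ∈ Finset.range k, u i) • X.barOp (-hodgeHomotopy hX) (initialWord k v) := by
  simp only [barOp_neg_hodgeHomotopy, DGAlgebra.barLambda_units_smul, map_units_smul]
  simp [Units.smul_def]

/-- The term of `barInsert (barOp) (a₀, …, a_{n-1})` that replaces the `l` letters following the
first `j` by their product. -/
noncomputable def insertedTerm (a : ℕ → X.harmonic) (j l t : ℕ) : A :=
  X.barOp (-hodgeHomotopy hX)
    ((initialWord j fun i => (a i : A)).map (fun x => -X.parity x) ++
      X.barOp (-hodgeHomotopy hX) (initialWord l fun s => (a (j + s) : A)) ::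
        initialWord t fun s => (a (j + (l + s)) : A))

theorem barInsert_initialWord (n : ℕ) (a : ℕ → X.harmonic) :
    X.barInsert (-hodgeHomotopy hX) (X.barOp (-hodgeHomotopy hX))
        (initialWord n fun i => (a i : A)) =
      ∑ j ∈ Finset.range (n + 1), ∑ l ∈ Finset.Icc 1 (n - j),
        insertedTerm hX a j l (n - j - l) := by
  rw [DGAlgebra.barInsert, insertSum, splitSum_initialWord]
  refine Finset.sum_congr rfl fun j _ => ?_
  rw [splitSum_initialWord, Finset.sum_range_succ']
  -- the insertions of an empty product, absent from the Stasheff identities, contribute zero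
  have h0 : ∀ u v : List A, X.barOp (-hodgeHomotopy hX)
      (u ++ X.barOp (-hodgeHomotopy hX) [] :: v) = 0 := by
    intro u v
    have := X.barLambda_smul (-hodgeHomotopy hX) u v 0 0
    rw [zero_smul, zero_smul] at this
    rw [barOp_nil, barOp_neg_hodgeHomotopy, this, map_zero]
    rfl
  rw [show (initialWord 0 fun k => (a (j + k) : A)) = [] from rfl, h0, add_zero]
  rw [← Nat.Ico_zero_eq_range]
  exact Finset.sum_Ico_add' (fun l => insertedTerm hX a j l (n - j - l)) 0 (n - j) 1

/-- Termwise comparison of a Stasheff identity with its bar form: the signs differ by a factor that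
depends only on the degrees of the arguments. -/
theorem stasheff_term {j l t : ℕ} {e : ℕ → ℤ} {a : ℕ → X.harmonic}
    (ha : ∀ i < j + (l + t), a i ∈ X.harmonicGrade (e i)) :
    ((j : ℤ) + l * t + l * ∑ i ∈ Finset.range j, e i).negOnePow •
      (harmonicOp hX (j + 1 + t) (fun i : Fin (j + 1 + t) =>
        if (i : ℕ) < j then a i
        else if (i : ℕ) = j then harmonicOp hX l (fun s : Fin l => a (j + s))
        else a (i + l - 1)) : A) =
      (barExponent (j + (l + t)) e).negOnePow • insertedTerm hX a j l t := by
  have hin : ∀ s < l, a (j + s) ∈ X.harmonicGrade (e (j + s)) := fun s hs => ha _ (by omega)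
  set B := ∑ s ∈ Finset.range l, e (j + s) with hB
  let e' : ℕ → ℤ := fun i => if i < j then e i else if i = j then B + 2 - l else e (i + l - 1)
  let z : ℕ → X.harmonic := fun i => if i < j then a i
    else if i = j then harmonicOp hX l (fun s : Fin l => a (j + s)) else a (i + l - 1)
  have hz : ∀ i < j + 1 + t, z i ∈ X.harmonicGrade (e' i) := by
    intro i hi
    simp only [z, e']
    split_ifs with h1 h2
    · exact ha i (by omega)
    · exact harmonicOp_mem hX (w := fun s => a (j + s)) (e := fun s => e (j + s)) hin
    · exact ha _ (by omega)
  -- the word obtained from the arguments by removing all signs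
  let z₀ : ℕ → A := fun i => if i < j then (a i : A) else if i = j then
    X.barOp (-hodgeHomotopy hX) (initialWord l fun s => (a (j + s) : A)) else (a (i + l - 1) : A)
  have hz₀ : ∀ i, (z i : A) = (if i = j then (barExponent l fun s => e (j + s)).negOnePow else 1) •
      z₀ i := by
    intro i
    simp only [z, z₀]
    by_cases h1 : i < j
    · simp [h1, h1.ne]
    · by_cases h2 : i = j
      · subst h2
        rw [harmonicOp_apply hX (w := fun s => a (i + s)) (e := fun s => e (i + s)) hin]
        simp [barOp_neg_hodgeHomotopy, Units.smul_def]
      · simp [h1, h2]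
  have hterm : insertedTerm hX a j l t =
      (∏ i ∈ Finset.range (j + 1 + t), if i < j then (e i + 1).negOnePow else 1) •
        X.barOp (-hodgeHomotopy hX) (initialWord (j + 1 + t) z₀) := by
    have hmap : (initialWord j fun i => (a i : A)).map (fun x => -X.parity x) =
        initialWord j fun i => (e i + 1).negOnePow • (a i : A) := by
      rw [initialWord, List.map_map]
      refine initialWord_congr fun i hi => ?_
      have := X.parity_of_mem (a := (a i : A)) (ha i (by omega))
      simp only [Function.comp_apply, this, Int.negOnePow_succ, Units.neg_smul]
    rw [← barOp_units_smul, insertedTerm, hmap, initialWord_append_cons]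
    congr 1
    refine initialWord_congr fun i hi => ?_
    simp only [z₀]
    split_ifs with h1 h2
    · rfl
    · rw [one_smul]
    · rw [one_smul]
      congr 2
      omega
  have hz₁ : (fun i => (z i : A)) = fun i =>
      (if i = j then (barExponent l fun s => e (j + s)).negOnePow else 1) • z₀ i := funext hz₀
  have hout := congrArg Subtype.val (harmonicOp_apply hX hz)
  rw [hz₁, DGAlgebra.barLambda_units_smul, map_units_smul, Finset.prod_ite_eq',
    if_pos (Finset.mem_range.2 (by omega)), smul_smul] at hout
  have hcoe : ∀ (u : ℤˣ) (x : X.harmonic), ((u • x : X.harmonic) : A) = u • (x : A) :=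
    fun u x => map_units_smul X.harmonic.subtype u x
  rw [hcoe, ← barOp_neg_hodgeHomotopy] at hout
  refine (congrArg _ hout).trans ?_
  rw [hterm, smul_smul, smul_smul]
  congr 1
  have hprod : (∏ i ∈ Finset.range (j + 1 + t), if i < j then (e i + 1).negOnePow else 1) =
      (∑ i ∈ Finset.range j, (e i + 1)).negOnePow := by
    rw [negOnePow_sum, add_assoc, Finset.prod_range_add]
    rw [Finset.prod_congr rfl fun i hi => if_pos (Finset.mem_range.1 hi)]
    rw [Finset.prod_eq_one (s := Finset.range (1 + t)) fun i _ => if_neg (by omega), mul_one]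
  rw [hprod, ← Int.negOnePow_add, ← Int.negOnePow_add, ← Int.negOnePow_add]
  have hsum : ∑ i ∈ Finset.range j, e' i = ∑ i ∈ Finset.range j, e i :=
    Finset.sum_congr rfl fun i hi => if_pos (Finset.mem_range.1 hi)
  have hj : barExponent j e' = barExponent j e :=
    barExponent_congr fun i hi => if_pos hi
  have ht : (barExponent t fun i => e' (j + (1 + i))) = barExponent t fun i => e (j + (l + i)) :=
    barExponent_congr fun i _ => by
      simp only [e']
      rw [if_neg (by omega), if_neg (by omega)]
      congr 1
      omega
  have hej : e' j = B + 2 - l := by simp [e']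
  apply negOnePow_congr (t : ℤ)
  rw [add_assoc j 1 t, barExponent_add j (1 + t), barExponent_add 1 t, barExponent_add j (l + t),
    barExponent_add l t, hsum, hj, ht, barExponent_one, Finset.sum_range_one, add_zero, hej,
    Finset.sum_add_distrib, ← hB]
  simp only [Finset.sum_const, Finset.card_range, nsmul_eq_mul, mul_one]
  push_cast
  ring

theorem stasheffSum_harmonicOp (n : ℕ) (e : ℕ → ℤ) (a : ℕ → X.harmonic)
    (ha : ∀ i < n, a i ∈ X.harmonicGrade (e i)) : stasheffSum (harmonicOp hX) n e a = 0 := by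
  have hbar : X.barInsert (-hodgeHomotopy hX) (X.barOp (-hodgeHomotopy hX))
      (initialWord n fun i => (a i : A)) = 0 := by
    refine X.barInsert_barOp (parity_neg_hodgeHomotopy hX) (fun b => ?_) _ fun x hx => ?_
    · have h := sub_bracket_hodgeHomotopy hX b
      have : b + (X.d ((-hodgeHomotopy hX) b) + (-hodgeHomotopy hX) (X.d b)) =
          harmonicPart hX b := by
        rw [← h]
        simp only [LinearMap.neg_apply, map_neg]
        abel
      rw [this]
      exact ((X.mem_harmonic_iff _).1 (Subtype.prop _)).1
    · obtain ⟨i, -, rfl⟩ := List.mem_map.1 hx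
      exact ((X.mem_harmonic_iff _).1 (Subtype.prop _)).1
  rw [barInsert_initialWord] at hbar
  have hcomm : ∀ F : ℕ → ℕ → A, ∑ l ∈ Finset.Icc 1 n, ∑ j ∈ Finset.range (n - l + 1), F l j =
      ∑ j ∈ Finset.range (n + 1), ∑ l ∈ Finset.Icc 1 (n - j), F l j := fun F =>
    Finset.sum_comm' fun l j => by
      simp only [Finset.mem_Icc, Finset.mem_range]
      omega
  apply Subtype.ext
  rw [stasheffSum, AddSubmonoidClass.coe_finsetSum]
  simp only [AddSubmonoidClass.coe_finsetSum]
  rw [hcomm]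
  refine Eq.trans ?_ (smul_zero (barExponent n e).negOnePow)
  rw [← hbar, Finset.smul_sum]
  refine Finset.sum_congr rfl fun j hj => ?_
  rw [Finset.smul_sum]
  refine Finset.sum_congr rfl fun l hl => ?_
  rw [Finset.mem_range] at hj
  rw [Finset.mem_Icc] at hl
  obtain ⟨t, rfl⟩ : ∃ t, n = j + (l + t) := ⟨n - j - l, by omega⟩
  have h := stasheff_term hX ha
  rw [show j + (l + t) - j - l = t by omega]
  rw [← h, show j + (l + t) - l + 1 = j + 1 + t by omega]
  refine (map_units_smul X.harmonic.subtype _ _).trans ?_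
  congr 3
  push_cast
  ring

/-- The `A∞`-structure on the harmonic space. -/
noncomputable def harmonicAInfinity : AInfinityStructure 𝕜 X.harmonic X.harmonicGrade where
  m := harmonicOp hX
  m_zero := by
    ext v
    change (harmonicPart hX (X.barLambda _ (List.ofFn _)) : A) = 0
    rw [List.ofFn_zero, DGAlgebra.barLambda_nil, map_zero]
    rfl
  degree k _ e a ha := by
    let e' : ℕ → ℤ := fun i => if h : i < k then e ⟨i, h⟩ else 0
    let a' : ℕ → X.harmonic := fun i => if h : i < k then a ⟨i, h⟩ else 0
    have h := harmonicOp_mem hX (k := k) (e := e') (w := a') fun i hi => by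
      simpa only [e', a', dif_pos hi] using ha ⟨i, hi⟩
    rw [Finset.sum_range] at h
    simpa [e', a'] using h
  stasheff n _ e a ha := stasheffSum_harmonicOp hX n e a ha

theorem isMerkulovStructure_harmonicAInfinity :
    IsMerkulovStructure X.toDGAlgebra X.harmonic (hodgeHomotopy hX) (harmonicAInfinity hX) := by
  constructor
  · intro w
    rw [((X.mem_harmonic_iff _).1 w.2).1]
    change (harmonicPart hX (X.barLambda _ (List.ofFn _)) : A) = 0
    rw [List.ofFn_succ, List.ofFn_zero, DGAlgebra.barLambda_singleton, map_zero]
    rfl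
  · intro k hk e w hw
    rw [sub_bracket_hodgeHomotopy, X.merkulovLambda_eq _ (fun _ _ h => hodgeHomotopy_mem hX h) _ k
      (Nat.lt_succ_self k) hk e (fun i => (w i : A)) hw, map_units_smul]
    exact congrArg Subtype.val (harmonicOp_apply hX hw)

theorem harmonicOp_two (α β : X.harmonic) :
    harmonicOp hX 2 ![α, β] = harmonicProduct hX α β := by
  change harmonicPart hX (X.barLambda _ (List.ofFn _)) = _
  simp [List.ofFn_succ, DGAlgebra.barLambda, splitSum, DGAlgebra.transfer,
    DGAlgebra.parity_parity, harmonicProduct]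

end MetricDGAlgebra

theorem mainTheorem1 {𝕜 A : Type*} [RCLike 𝕜] [NonUnitalRing A] [Module 𝕜 A]
    [IsScalarTower 𝕜 A A] [SMulCommClass 𝕜 A A]
    (X : MetricDGAlgebra 𝕜 A) (hX : X.HasHodgeDecomposition) :
    DirectSum.IsInternal X.harmonicGrade ∧
    IsMerkulovDatum X.toDGAlgebra X.harmonic (MetricDGAlgebra.hodgeHomotopy hX) ∧
    ∃ M : AInfinityStructure 𝕜 X.harmonic X.harmonicGrade,
      (∀ α β : X.harmonic, M.m 2 ![α, β] = MetricDGAlgebra.harmonicProduct hX α β) ∧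
      M.m 1 = 0 ∧
      IsMerkulovStructure X.toDGAlgebra X.harmonic (MetricDGAlgebra.hodgeHomotopy hX) M ∧
      ∀ M' : AInfinityStructure 𝕜 X.harmonic X.harmonicGrade,
        IsMerkulovStructure X.toDGAlgebra X.harmonic (MetricDGAlgebra.hodgeHomotopy hX) M' →
          M' = M := by
  exact ⟨X.isInternal_harmonicGrade, MetricDGAlgebra.isMerkulovDatum_harmonic hX,
    MetricDGAlgebra.harmonicAInfinity hX, MetricDGAlgebra.harmonicOp_two hX,
    by
      ext v
      rw [show v = fun _ => v 0 from funext fun i => congrArg v (Subsingleton.elim _ _),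
        (MetricDGAlgebra.isMerkulovStructure_harmonicAInfinity hX).1]
      exact ((X.mem_harmonic_iff _).1 (v 0).2).1,
    MetricDGAlgebra.isMerkulovStructure_harmonicAInfinity hX,
    fun _ hM' => MetricDGAlgebra.merkulovStructure_unique hX hM'
      (MetricDGAlgebra.isMerkulovStructure_harmonicAInfinity hX)⟩
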